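/- **Setting.** There are $n\ge 1$ clients; client $i$ holds a local dataset $D_i=(d_{i,1},\dots,d_{i,m})$ of $m\ge1$ samples. For a loss $f(x;z)$, $x\in\mathbb R^d$ ($d\ge1$), put $f_{i,j}(x)=f(x;d_{i,j})$, $f_i=\frac1m\sum_{j}f_{i,j}$ and $f=\frac1n\sum_i f_i$. Assume that for every sample $z$ the function $f(\cdot;z)$ is differentiable, its gradient is $L$-Lipschitz ($L\ge 0$), and $\|\nabla f(x;z)\|\le G$ for all $x$ ($G>0$). A randomized map $\mathcal C:\mathbb R^d\to\mathbb R^d$ is an $\omega$-compressor ($\omega\ge0$) if $\mathbb E[\mathcal C(x)]=x$ and $\mathbb E\|\mathcal C(x)-x\|^2\le\omega\|x\|^2$ for all $x$. **Algorithm CDP-SGD** (initial point $x^0$, stepsize $\eta$, noise level $\sigma_p$, minibatch size $b$, $T$ rounds). In round $t=0,\dots,T-1$ every client $i$ draws a random minibatch $\mathcal I_i^t\subseteq\{1,\dots,m\}$ containing each index independently with probability $b/m$, forms $g_i^t=\frac1b\sum_{j\in\mathcal I_i^t}\nabla f_{i,j}(x^t)+\xi_i^t$ with $\xi_i^t\sim\mathcal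 N(0,\sigma_p^2 I)$, and sends $v_i^t=\mathcal C_i^t(g_i^t)$ to the server, which sets $x^{t+1}=x^t-\eta\,\frac1n\sum_{i=1}^n v_i^t$. Here the $\mathcal C_i^t$ are $\omega$-compressors, and all minibatches, noises and compressors are independent. The algorithm is $(\epsilon,\delta)$-LDP if for every client $i$, all data of the other clients, any two local datasets $D_i,D_i'$ that differ in only one entry, and every measurable set $S$ of possible values of the tuple of all messages $(v_k^t)_{t<T,\,k\le n}$, one has $\Pr_{D_i}\{(v_k^t)\in S\}\le e^{\epsilon}\Pr_{D_i'}\{(v_k^t)\in S\}+\delta$. **Theorem.** For every $K>0$ there are constants $A,c>0$, depending only on $K$, such that the following holds. Let $n,m,d\ge 1$, $L\ge0$, $G>0$, $\omega\ge0$, $\Delta>0$, $\delta\in(0,1)$ and $0<\epsilon\le K\log(1/\delta)$, and put $$R=\frac{\sqrt{nL\Delta}\,m\epsilon}{G\sqrt{(1+\omega)d\log(1/\delta)}}+\frac{m^2\epsilon^2}{d\log(1/\delta)} .$$ There are an integer $T\ge1$ with $R/A\le T\le 1+A\,R$, a stepsize $\eta>0$ and a noise level $\sigma_p>0$, depending only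 on these parameters, such that for every minibatch size $b\in\{1,\dots,m\}$ with $b=m$ or $\epsilon\le c\,(b/m)^2T$, for every loss $f(x;z)$ as above, all $\omega$-compressors $\mathcal C_i^t$ and every initial point $x^0$: 1. CDP-SGD with $T$ rounds is $(\epsilon,\delta)$-LDP; 2. for every dataset such that $f$ is bounded below and $f(x^0)-\inf_x f(x)\le\Delta$, $$\frac1T\sum_{t=0}^{T-1}\mathbb E\|\nabla f(x^t)\|^2\le A\,\frac{G\sqrt{(1+\omega)L\Delta\, d\log(1/\delta)}}{\sqrt n\,m\epsilon}.$$ -/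

import Mathlib

open MeasureTheory ProbabilityTheory

namespace CDPSGD

/-- The space of model parameters, with its Euclidean norm. -/
abbrev Vec (d : ℕ) := EuclideanSpace ℝ (Fin d)

/-! ### Loss functions -/

/-- `f` is `L`-smooth: differentiable, with an `L`-Lipschitz gradient. -/
def IsSmooth {d : ℕ} (L : ℝ) (f : Vec d → ℝ) : Prop :=
  Differentiable ℝ f ∧ ∀ x y, ‖gradient f x - gradient f y‖ ≤ L * ‖x - y‖

/-- The gradient of `f` is bounded by `G` in norm. -/
def HasBoundedGradient {d : ℕ} (G : ℝ) (f : Vec d → ℝ) : Prop :=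
  ∀ x, ‖gradient f x‖ ≤ G

/-- The local objective of a client with dataset `D`; `f z x` is the loss of the model `x`
on the data sample `z`. -/
noncomputable def localLoss {Z : Type*} {d m : ℕ} (f : Z → Vec d → ℝ) (D : Fin m → Z)
    (x : Vec d) : ℝ :=
  (1 / (m : ℝ)) * ∑ j, f (D j) x

/-- The global objective; `D i` is the local dataset of client `i`. -/
noncomputable def globalLoss {Z : Type*} {d n m : ℕ} (f : Z → Vec d → ℝ)
    (D : Fin n → Fin m → Z) (x : Vec d) : ℝ :=
  (1 / (n : ℝ)) * ∑ i, localLoss f (D i) x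

/-! ### Compression operators -/

/-- A randomized `ω`-compression operator on `ℝ^d`: a Markov kernel `C` (so `C x` is the law of the
random output on the input `x`) with `E[C(x)] = x` and `E‖C(x) - x‖² ≤ ω ‖x‖²` for all `x`. -/
structure Compressor (d : ℕ) (ω : ℝ) where
  kernel : Kernel (Vec d) (Vec d)
  isMarkov : IsMarkovKernel kernel
  integrable : ∀ x, Integrable (fun y => y) (kernel x)
  mean_eq : ∀ x, ∫ y, y ∂(kernel x) = x
  integrable_sq : ∀ x, Integrable (fun y => ‖y - x‖ ^ 2) (kernel x)
  variance_le : ∀ x, ∫ y, ‖y - x‖ ^ 2 ∂(kernel x) ≤ ω * ‖x‖ ^ 2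

instance {d : ℕ} {ω : ℝ} (C : Compressor d ω) : IsMarkovKernel C.kernel := C.isMarkov

/-! ### Local differential privacy -/

/-- Two local datasets are neighbors if they differ in at most one entry. -/
def Neighbors {Z : Type*} {m : ℕ} (D D' : Fin m → Z) : Prop :=
  ∃ j, ∀ k, k ≠ j → D k = D' k

/-- `(ε, δ)`-differential privacy of the randomized mechanism `M` of a local dataset; `M D` is the
law of its output on the dataset `D`. -/
def IsLDP {Z R : Type*} {m : ℕ} [MeasurableSpace R] (ε δ : ℝ) (M : (Fin m → Z) → Measure R) :
    Prop :=
  ∀ D D', Neighbors D D' → ∀ S, MeasurableSet S →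
    M D S ≤ ENNReal.ofReal (Real.exp ε) * M D' S + ENNReal.ofReal δ

/-! ### The algorithm -/

/-- The law of a random minibatch, coded by its indicator function: each of the `m` samples is
included independently with probability `b / m` (for `b ≤ m`). -/
noncomputable def minibatchLaw (b m : ℕ) : Measure (Fin m → Bool) :=
  Measure.pi fun _ =>
    bernoulliMeasure true false (Set.projIcc (0 : ℝ) 1 zero_le_one ((b : ℝ) / (m : ℝ)))

instance (b m : ℕ) : IsProbabilityMeasure (minibatchLaw b m) := by
  unfold minibatchLaw; infer_instance

/-- The Gaussian law `N(0, σ² I)` on `ℝ^d`. -/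
noncomputable def noiseLaw (d : ℕ) (σ : ℝ) : Measure (Vec d) :=
  (stdGaussian (Vec d)).map fun ξ => σ • ξ

instance (d : ℕ) (σ : ℝ) : IsProbabilityMeasure (noiseLaw d σ) :=
  Measure.isProbabilityMeasure_map (by fun_prop)

/-- The minibatch gradient `(1/b) ∑_{j ∈ S} ∇f(x; D_j)` on the minibatch with indicator `S`. -/
noncomputable def stochGrad {Z : Type*} {d m : ℕ} (f : Z → Vec d → ℝ) (D : Fin m → Z) (b : ℕ)
    (x : Vec d) (S : Fin m → Bool) : Vec d :=
  (1 / (b : ℝ)) • ∑ j, if S j then gradient (f (D j)) x else 0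

lemma measurable_gradient {d : ℕ} (f : Vec d → ℝ) : Measurable (gradient f) :=
  (InnerProductSpace.toDual ℝ (Vec d)).symm.continuous.measurable.comp (measurable_fderiv ℝ f)

lemma measurable_perturbedGrad {Z : Type*} {d m : ℕ} (f : Z → Vec d → ℝ) (D : Fin m → Z)
    (b : ℕ) : Measurable fun p : Vec d × ((Fin m → Bool) × Vec d) =>
      stochGrad f D b p.1 p.2.1 + p.2.2 := by
  unfold stochGrad
  refine Measurable.add (Measurable.fun_const_smul
    (Finset.measurable_fun_sum Finset.univ fun j _ => ?_) _) (by fun_prop)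
  refine Measurable.ite ?_ ((measurable_gradient _).comp measurable_fst) measurable_const
  exact (show Measurable fun p : Vec d × ((Fin m → Bool) × Vec d) => p.2.1 j by fun_prop)
    (measurableSet_singleton true)

/-- Local computation and privacy step: `x` is sent to the law of `g̃ + ξ`, where `g̃` is a minibatch
gradient at `x` and `ξ ∼ N(0, σ² I)` is independent of the minibatch. -/
noncomputable def perturbedGradKernel {Z : Type*} {d m : ℕ} (f : Z → Vec d → ℝ) (D : Fin m → Z)
    (b : ℕ) (σ : ℝ) : Kernel (Vec d) (Vec d) :=
  (Kernel.id ×ₖ Kernel.const _ ((minibatchLaw b m).prod (noiseLaw d σ))).map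
    fun p => stochGrad f D b p.1 p.2.1 + p.2.2

instance {Z : Type*} {d m : ℕ} (f : Z → Vec d → ℝ) (D : Fin m → Z) (b : ℕ) (σ : ℝ) :
    IsMarkovKernel (perturbedGradKernel f D b σ) :=
  Kernel.IsMarkovKernel.map _ (measurable_perturbedGrad f D b)

/-- Direct compression: `x` is sent to the law of the message `C(g̃ + ξ)` of one client. -/
noncomputable def messageKernel {Z : Type*} {d m : ℕ} {ω : ℝ} (f : Z → Vec d → ℝ) (D : Fin m → Z)
    (b : ℕ) (σ : ℝ) (C : Compressor d ω) : Kernel (Vec d) (Vec d) :=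
  C.kernel ∘ₖ perturbedGradKernel f D b σ

instance {Z : Type*} {d m : ℕ} {ω : ℝ} (f : Z → Vec d → ℝ) (D : Fin m → Z) (b : ℕ) (σ : ℝ)
    (C : Compressor d ω) : IsMarkovKernel (messageKernel f D b σ C) := by
  unfold messageKernel; infer_instance

/-- One communication round: `x` is sent to the joint law of the messages of the `n` clients, which
are independent given `x`; `C i` is the compressor of client `i` in this round. -/
noncomputable def roundKernel {Z : Type*} {d n m : ℕ} {ω : ℝ} (f : Z → Vec d → ℝ)
    (D : Fin n → Fin m → Z) (b : ℕ) (σ : ℝ) (C : Fin n → Compressor d ω) :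
    Kernel (Vec d) (Fin n → Vec d) where
  toFun x := Measure.pi fun i => messageKernel f (D i) b σ (C i) x
  measurable' := by
    refine Measurable.measure_of_isPiSystem_of_isProbabilityMeasure
      generateFrom_pi.symm isPiSystem_pi ?_
    rintro _ ⟨s, hs, rfl⟩
    simp only [Measure.pi_pi]
    exact Finset.measurable_fun_prod _ fun i _ =>
      Kernel.measurable_coe _ (hs i (Set.mem_univ i))

instance {Z : Type*} {d n m : ℕ} {ω : ℝ} (f : Z → Vec d → ℝ) (D : Fin n → Fin m → Z) (b : ℕ)
    (σ : ℝ) (C : Fin n → Compressor d ω) : IsMarkovKernel (roundKernel f D b σ C) :=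
  ⟨fun x => by
    change IsProbabilityMeasure (Measure.pi fun i => messageKernel f (D i) b σ (C i) x)
    infer_instance⟩

/-- The model `x^t = x^0 - ∑_{s < t} η_s v^s` that the server holds after the messages `h s i`
(`s < t`, client `i`), where `v^s` is the average of the messages of round `s`. -/
noncomputable def model {d n : ℕ} (η : ℕ → ℝ) (x0 : Vec d) {t : ℕ} (h : Fin t → Fin n → Vec d) :
    Vec d :=
  x0 - ∑ s : Fin t, η s • ((1 / (n : ℝ)) • ∑ i, h s i)

lemma measurable_model {d n : ℕ} (η : ℕ → ℝ) (x0 : Vec d) (t : ℕ) :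
    Measurable fun h : Fin t → Fin n → Vec d => model η x0 h := by
  unfold model; fun_prop

/-- The joint law of all messages sent to the server in the first `T` rounds (rounds
`0, …, T - 1`): given the messages of the rounds before `t`, those of round `t` have the law
`roundKernel` at the current model `x^t`. -/
noncomputable def transcriptLaw {Z : Type*} {d n m : ℕ} {ω : ℝ} (f : Z → Vec d → ℝ)
    (D : Fin n → Fin m → Z) (b : ℕ) (η : ℕ → ℝ) (σ : ℝ) (C : ℕ → Fin n → Compressor d ω)
    (x0 : Vec d) : (T : ℕ) → Measure (Fin T → Fin n → Vec d)
  | 0 => Measure.dirac fun s => s.elim0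
  | t + 1 =>
    ((transcriptLaw f D b η σ C x0 t) ⊗ₘ
        ((roundKernel f D b σ (C t)).comap (model η x0) (measurable_model η x0 t))).map
      fun p => Fin.snoc (α := fun _ => Fin n → Vec d) p.1 p.2

/-- The utility `(1/T) ∑_{t < T} E ‖∇f(x^t)‖²`. -/
noncomputable def avgSqGradNorm {Z : Type*} {d n m : ℕ} {ω : ℝ} (f : Z → Vec d → ℝ)
    (D : Fin n → Fin m → Z) (b : ℕ) (η : ℕ → ℝ) (σ : ℝ) (C : ℕ → Fin n → Compressor d ω)
    (x0 : Vec d) (T : ℕ) : ℝ :=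
  (1 / (T : ℝ)) * ∑ t ∈ Finset.range T,
    ∫ h, ‖gradient (globalLoss f D) (model η x0 h)‖ ^ 2 ∂(transcriptLaw f D b η σ C x0 t)

/-- The order of the number of communication rounds. -/
noncomputable def roundOrder (n m d : ℕ) (L G ω ε δ Δ : ℝ) : ℝ :=
  √(n * L * Δ) * m * ε / (G * √((1 + ω) * d * Real.log (1 / δ)))
    + m ^ 2 * ε ^ 2 / (d * Real.log (1 / δ))

/-- The order of the average squared gradient norm. -/
noncomputable def utilityOrder (n m d : ℕ) (L G ω ε δ Δ : ℝ) : ℝ :=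
  G * √((1 + ω) * L * Δ * d * Real.log (1 / δ)) / (√n * m * ε)

end CDPSGD

/-!
Privacy. A probability measure is compared with another one by the Hölder-type domination
`∫ g dμ ≤ C (∫ g ^ p dν) ^ (1 / p)`; for `p` conjugate to `α` this bounds the Rényi divergence of
order `α`. The constants multiply over adaptive rounds and do not grow under post-processing, so
neither the compressors nor the server enter the argument, and it is enough to compare the messages
of a single client before compression in a single round. Given the rest of the minibatch, these are
Gaussian vectors whose mean is shifted with probability `b / m` by a vector `u` of norm at most
`G / b`, where only `u` depends on the sample that differs; hence `C = exp (O(α (G / (m σ)) ^ 2))`.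
With `α` of order `log (1 / δ) / ε` and `σ ^ 2` of order `G ^ 2 T log (1 / δ) / (m ε) ^ 2`, the `T`
rounds together are `(ε, δ)`-private.

Utility. By the law of total variance, the mean of the `n` messages is an unbiased estimator of the
gradient with variance of order `(1 + ω) (G ^ 2 + d σ ^ 2) / n`. The descent lemma, summed over the
rounds, bounds the average squared gradient norm by `Δ / (η T)` plus `η L` times this variance, up
to constants. Once `T` reaches the order `R`, the privacy noise dominates `G ^ 2` and the stepsize
that balances the two terms satisfies `η L ≤ 1`.
-/

namespace CDPSGD

open scoped ENNReal RealInnerProductSpace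

/-! ### Hölder domination of measures -/

section Update

variable {ι : Type*} [Fintype ι] [DecidableEq ι] {X : ι → Type*} [∀ i, MeasurableSpace (X i)]

lemma map_update_pi_prod (μ : ∀ i, Measure (X i)) [∀ i, IsProbabilityMeasure (μ i)] (i : ι)
    (ρ : Measure (X i)) [SigmaFinite ρ] :
    ((Measure.pi μ).prod ρ).map (fun p => Function.update p.1 i p.2)
      = Measure.pi (Function.update μ i ρ) := by
  have : ∀ j, SigmaFinite (Function.update μ i ρ j) := fun j => by
    obtain rfl | hj := eq_or_ne j i
    · rwa [Function.update_self]
    · rw [Function.update_of_ne hj]; infer_instance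
  symm
  refine Measure.pi_eq fun s hs => ?_
  have hpre : (fun p : (∀ j, X j) × X i => Function.update p.1 i p.2) ⁻¹' Set.univ.pi s
      = (Set.univ.pi (Function.update s i Set.univ)) ×ˢ s i := by
    ext ⟨x, y⟩
    simp only [Set.mem_preimage, Set.mem_univ_pi, Set.mem_prod]
    refine ⟨fun h => ⟨fun j => ?_, by simpa using h i⟩, fun h j => ?_⟩
    · obtain rfl | hj := eq_or_ne j i
      · simp
      · simpa [hj] using h j
    · obtain rfl | hj := eq_or_ne j i
      · simpa using h.2
      · simpa [hj] using h.1 j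
  rw [Measure.map_apply measurable_update' (.univ_pi hs), hpre, Measure.prod_prod, Measure.pi_pi,
    ← Finset.prod_erase_mul _ _ (Finset.mem_univ i),
    ← Finset.prod_erase_mul Finset.univ _ (Finset.mem_univ i)]
  simp only [Function.update_self, measure_univ, mul_one]
  congr 1
  refine Finset.prod_congr rfl fun j hj => ?_
  simp only [Function.update_of_ne (Finset.ne_of_mem_erase hj)]

end Update

lemma map_id_prod_const_apply {X Y W : Type*} [MeasurableSpace X] [MeasurableSpace Y]
    [MeasurableSpace W] (τ : Measure Y) [SFinite τ] {ψ : X × Y → W} (hψ : Measurable ψ) (x : X) :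
    (Kernel.id ×ₖ Kernel.const X τ).map ψ x = τ.map fun y => ψ (x, y) := by
  rw [Kernel.map_apply _ hψ, Kernel.prod_apply, Kernel.id_apply, Kernel.const_apply,
    Measure.dirac_prod, Measure.map_map hψ measurable_prodMk_left]
  rfl

/-- `μ` is dominated by `ν` with exponent `p` and constant `C`: `∫ g dμ ≤ C (∫ g ^ p dν) ^ (1 / p)`
for all measurable `g ≥ 0`. For `p > 1` this is the dual form of the bound `‖dμ/dν‖ ≤ C` in
`L^α(ν)`, `α` being the conjugate exponent, i.e. of a bound of the Rényi divergence of order `α`.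
The dual form makes composition, post-processing and mixing immediate. -/
def HolderDominated {X : Type*} [MeasurableSpace X] (p : ℝ) (C : ℝ≥0∞) (μ ν : Measure X) : Prop :=
  ∀ g : X → ℝ≥0∞, Measurable g → ∫⁻ x, g x ∂μ ≤ C * (∫⁻ x, g x ^ p ∂ν) ^ (1 / p)

namespace HolderDominated

variable {X Y W : Type*} [MeasurableSpace X] [MeasurableSpace Y] [MeasurableSpace W]
  {p : ℝ} {C C' : ℝ≥0∞} {μ ν : Measure X}

lemma refl (hp : 1 < p) (μ : Measure X) [IsProbabilityMeasure μ] : HolderDominated p 1 μ μ :=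
  fun g hg => by
    simpa using ENNReal.lintegral_mul_le_Lp_mul_Lq μ (Real.HolderConjugate.conjExponent hp)
      hg.aemeasurable (g := fun _ => 1) aemeasurable_const

lemma mono (h : HolderDominated p C μ ν) (hC : C ≤ C') : HolderDominated p C' μ ν :=
  fun g hg => (h g hg).trans (mul_le_mul_left hC _)

lemma map (h : HolderDominated p C μ ν) {f : X → Y} (hf : Measurable f) :
    HolderDominated p C (μ.map f) (ν.map f) := fun g hg => by
  rw [lintegral_map hg hf, lintegral_map (hg.pow_const p) hf]
  exact h _ (hg.comp hf)

lemma compProd (hp : 1 < p) [SFinite μ] [SFinite ν] (h : HolderDominated p C μ ν)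
    {κ κ' : Kernel X Y} [IsSFiniteKernel κ] [IsSFiniteKernel κ']
    (hκ : ∀ x, HolderDominated p C' (κ x) (κ' x)) :
    HolderDominated p (C * C') (μ ⊗ₘ κ) (ν ⊗ₘ κ') := fun g hg => by
  rw [Measure.lintegral_compProd hg, Measure.lintegral_compProd (hg.pow_const p)]
  have hm : Measurable fun x => ∫⁻ y, g (x, y) ^ p ∂(κ' x) :=
    (hg.pow_const p).lintegral_kernel_prod_right'
  have hp0 : p ≠ 0 := by positivity
  calc ∫⁻ x, ∫⁻ y, g (x, y) ∂κ x ∂μ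
      ≤ ∫⁻ x, C' * (∫⁻ y, g (x, y) ^ p ∂(κ' x)) ^ (1 / p) ∂μ :=
        lintegral_mono fun x => hκ x _ (hg.comp measurable_prodMk_left)
    _ = C' * ∫⁻ x, (∫⁻ y, g (x, y) ^ p ∂(κ' x)) ^ (1 / p) ∂μ :=
        lintegral_const_mul _ (hm.pow_const _)
    _ ≤ C' * (C * (∫⁻ x, ((∫⁻ y, g (x, y) ^ p ∂(κ' x)) ^ (1 / p)) ^ p ∂ν) ^ (1 / p)) := by
        gcongr; exact h _ (hm.pow_const _)
    _ = C * C' * (∫⁻ x, ∫⁻ y, g (x, y) ^ p ∂(κ' x) ∂ν) ^ (1 / p) := by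
        simp_rw [← ENNReal.rpow_mul, one_div, inv_mul_cancel₀ hp0, ENNReal.rpow_one]
        ring

lemma bind (hp : 1 < p) [SFinite μ] [SFinite ν] (h : HolderDominated p C μ ν)
    {κ κ' : Kernel X Y} [IsSFiniteKernel κ] [IsSFiniteKernel κ']
    (hκ : ∀ x, HolderDominated p C' (κ x) (κ' x)) :
    HolderDominated p (C * C') (κ ∘ₘ μ) (κ' ∘ₘ ν) := by
  rw [← Measure.snd_compProd, ← Measure.snd_compProd]
  exact (h.compProd hp hκ).map measurable_snd

lemma map_prod (hp : 1 < p) {ρ : Measure X} [IsProbabilityMeasure ρ] {τ τ' : Measure Y}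
    [IsFiniteMeasure τ] [IsFiniteMeasure τ'] {φ φ' : X × Y → W} (hφ : Measurable φ)
    (hφ' : Measurable φ')
    (h : ∀ x, HolderDominated p C (τ.map fun y => φ (x, y)) (τ'.map fun y => φ' (x, y))) :
    HolderDominated p C ((ρ.prod τ).map φ) ((ρ.prod τ').map φ') := by
  have hbind : ∀ (τ : Measure Y) [IsFiniteMeasure τ] {ψ : X × Y → W}, Measurable ψ →
      (ρ.prod τ).map ψ = ((Kernel.id ×ₖ Kernel.const X τ).map ψ) ∘ₘ ρ := fun τ _ _ hψ => by
    rw [← Measure.map_comp _ _ hψ, ← Measure.compProd_eq_comp_prod, Measure.compProd_const]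
  rw [hbind τ hφ, hbind τ' hφ', ← one_mul C]
  exact (refl hp ρ).bind hp fun x => by
    rw [map_id_prod_const_apply τ hφ, map_id_prod_const_apply τ' hφ']
    exact h x

lemma pi {ι : Type*} [Fintype ι] {X : ι → Type*} [∀ i, MeasurableSpace (X i)]
    (hp : 1 < p) {μ ν : ∀ i, Measure (X i)} [∀ i, IsProbabilityMeasure (μ i)]
    [∀ i, IsProbabilityMeasure (ν i)] (i : ι) (hne : ∀ k, k ≠ i → μ k = ν k)
    (h : HolderDominated p C (μ i) (ν i)) :
    HolderDominated p C (Measure.pi μ) (Measure.pi ν) := by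
  classical
  have hν : ν = Function.update μ i (ν i) := by
    funext k
    obtain rfl | hk := eq_or_ne k i
    · rw [Function.update_self]
    · rw [Function.update_of_ne hk, hne k hk]
  have hupdate := map_prod (ρ := Measure.pi μ) hp (measurable_update' (a := i))
    (measurable_update' (a := i)) fun x => h.map (measurable_update x)
  rwa [map_update_pi_prod, map_update_pi_prod, Function.update_eq_self, ← hν] at hupdate

lemma measure_le {C ε δ : ℝ} (hp : 1 < p) (h : HolderDominated p (ENNReal.ofReal C) μ ν)
    [IsProbabilityMeasure ν] (hδ : 0 < δ)
    (hC : C ≤ Real.exp (ε * (1 / p)) * δ ^ (1 - 1 / p)) {S : Set X} (hS : MeasurableSet S) :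
    μ S ≤ ENNReal.ofReal (Real.exp ε) * ν S + ENNReal.ofReal δ := by
  have hp0 : 0 < p := by positivity
  have hinv0 : 0 < 1 / p := by positivity
  have hinv1 : 1 / p < 1 := (div_lt_one hp0).2 hp
  have hind : ∀ x, S.indicator (fun _ => (1 : ℝ≥0∞)) x ^ p = S.indicator (fun _ => 1) x :=
    fun x => by by_cases hx : x ∈ S <;> simp [hx, hp0]
  have hμS : μ S ≤ ENNReal.ofReal C * ν S ^ (1 / p) := by
    have := h (S.indicator fun _ => 1) (measurable_const.indicator hS)
    simp_rw [hind] at this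
    rwa [lintegral_indicator_const hS, lintegral_indicator_const hS, one_mul, one_mul] at this
  have hyoung : Real.exp (ε * (1 / p)) * ν.real S ^ (1 / p) * δ ^ (1 - 1 / p)
      ≤ 1 / p * (Real.exp ε * ν.real S) + (1 - 1 / p) * δ := by
    have := Real.geom_mean_le_arith_mean2_weighted hinv0.le (sub_nonneg.2 hinv1.le)
      (mul_nonneg (Real.exp_pos ε).le (measureReal_nonneg (μ := ν) (s := S))) hδ.le (by ring)
    rwa [Real.mul_rpow (Real.exp_pos ε).le measureReal_nonneg, ← Real.exp_mul] at this
  refine hμS.trans ?_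
  rw [← ofReal_measureReal (μ := ν) (s := S),
    ENNReal.ofReal_rpow_of_nonneg measureReal_nonneg hinv0.le,
    ← ENNReal.ofReal_mul' (by positivity), ← ENNReal.ofReal_mul (by positivity),
    ← ENNReal.ofReal_add (by positivity) hδ.le]
  refine ENNReal.ofReal_le_ofReal ?_
  calc C * ν.real S ^ (1 / p)
      ≤ Real.exp (ε * (1 / p)) * δ ^ (1 - 1 / p) * ν.real S ^ (1 / p) := by gcongr
    _ ≤ 1 / p * (Real.exp ε * ν.real S) + (1 - 1 / p) * δ := by linarith
    _ ≤ 1 * (Real.exp ε * ν.real S) + 1 * δ := by gcongr; linarith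
    _ = Real.exp ε * ν.real S + δ := by ring

lemma withDensity {α : ℝ} (hpα : p.HolderConjugate α) {P Q : X → ℝ≥0∞} (hP : Measurable P)
    (hQ : Measurable Q) (hQ0 : ∀ x, Q x ≠ 0) (hQtop : ∀ x, Q x ≠ ⊤) :
    HolderDominated p ((∫⁻ x, P x ^ α * (Q x)⁻¹ ^ (α - 1) ∂μ) ^ (1 / α))
      (μ.withDensity P) (μ.withDensity Q) := fun g hg => by
  rw [lintegral_withDensity_eq_lintegral_mul _ hP hg,
    lintegral_withDensity_eq_lintegral_mul _ hQ (hg.pow_const p)]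
  have hp := hpα.pos
  have hsplit : ∀ x, (P * g) x = (P x * (Q x)⁻¹ ^ (1 / p)) * (Q x ^ (1 / p) * g x) := fun x => by
    have hQQ : (Q x)⁻¹ ^ (1 / p) * Q x ^ (1 / p) = 1 := by
      rw [← ENNReal.mul_rpow_of_nonneg _ _ (by positivity),
        ENNReal.inv_mul_cancel (hQ0 x) (hQtop x), ENNReal.one_rpow]
    calc P x * g x = P x * ((Q x)⁻¹ ^ (1 / p) * Q x ^ (1 / p)) * g x := by rw [hQQ, mul_one]
      _ = _ := by ring
  have hPQ : ∀ x, (P x * (Q x)⁻¹ ^ (1 / p)) ^ α = P x ^ α * (Q x)⁻¹ ^ (α - 1) := fun x => by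
    rw [ENNReal.mul_rpow_of_nonneg _ _ hpα.symm.nonneg, ← ENNReal.rpow_mul, one_div_mul_eq_div,
      hpα.symm.div_conj_eq_sub_one]
  have hQg : ∀ x, (Q x ^ (1 / p) * g x) ^ p = (Q * fun x => g x ^ p) x := fun x => by
    rw [ENNReal.mul_rpow_of_nonneg _ _ hp.le, ← ENNReal.rpow_mul, one_div_mul_cancel hp.ne',
      ENNReal.rpow_one, Pi.mul_apply]
  simp_rw [hsplit, ← hPQ, ← hQg]
  exact ENNReal.lintegral_mul_le_Lp_mul_Lq μ hpα.symm (by fun_prop) (by fun_prop)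

lemma withDensity_of_moments {α : ℕ} (hα : 2 ≤ α) {P Q : X → ℝ≥0∞} (hP : Measurable P)
    (hQ : Measurable Q) (hQ0 : ∀ x, Q x ≠ 0) (hQtop : ∀ x, Q x ≠ ⊤) {A B : ℝ≥0∞}
    (hA : ∫⁻ x, P x ^ (2 * α) ∂μ ≤ A) (hB : ∫⁻ x, (Q x)⁻¹ ^ (2 * (α - 1)) ∂μ ≤ B) :
    HolderDominated (α / (α - 1)) ((A * B) ^ (1 / (2 * α : ℝ)))
      (μ.withDensity P) (μ.withDensity Q) := fun g hg => by
  have hα1 : (1 : ℝ) < α := by exact_mod_cast hα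
  refine (withDensity (Real.HolderConjugate.conjExponent hα1).symm hP hQ hQ0 hQtop g hg).trans ?_
  refine mul_le_mul_left ?_ _
  have hsub : (α : ℝ) - 1 = (α - 1 : ℕ) := by push_cast [Nat.cast_sub (by omega : 1 ≤ α)]; ring
  have hcs := ENNReal.lintegral_mul_le_Lp_mul_Lq μ Real.HolderConjugate.two_two
    (hP.pow_const α).aemeasurable (hQ.inv.pow_const (α - 1)).aemeasurable
  simp only [Pi.mul_apply, Pi.inv_apply, ENNReal.rpow_ofNat, ← pow_mul, mul_comm _ 2] at hcs
  simp_rw [hsub, ENNReal.rpow_natCast]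
  calc (∫⁻ x, P x ^ α * (Q x)⁻¹ ^ (α - 1) ∂μ) ^ (1 / (α : ℝ))
      ≤ (A ^ (1 / 2 : ℝ) * B ^ (1 / 2 : ℝ)) ^ (1 / (α : ℝ)) := by
        refine ENNReal.rpow_le_rpow (hcs.trans ?_) (by positivity)
        gcongr
    _ = (A * B) ^ (1 / (2 * α : ℝ)) := by
        rw [← ENNReal.mul_rpow_of_nonneg _ _ (by norm_num), ← ENNReal.rpow_mul]
        congr 1
        field_simp

end HolderDominated

/-! ### Translations of the standard Gaussian measure -/

section GaussianShift

variable {E : Type*} [NormedAddCommGroup E] [InnerProductSpace ℝ E]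

/-- The density at `z` of `N(u, I)` with respect to `N(0, I)`. -/
noncomputable def shiftDensity (u z : E) : ℝ :=
  Real.exp (⟪u, z⟫ - ‖u‖ ^ 2 / 2)

lemma shiftDensity_pos (u z : E) : 0 < shiftDensity u z := Real.exp_pos _

lemma shiftDensity_zero_left (z : E) : shiftDensity 0 z = 1 := by simp [shiftDensity]

lemma shiftDensity_add_smul (u z : E) (t : ℝ) :
    shiftDensity u (z + t • u) = Real.exp (t * ‖u‖ ^ 2) * shiftDensity u z := by
  rw [shiftDensity, shiftDensity, inner_add_right, real_inner_smul_right,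
    real_inner_self_eq_norm_sq, ← Real.exp_add]
  ring_nf

lemma shiftDensity_add_self (u z : E) :
    shiftDensity u (z + u) = Real.exp (‖u‖ ^ 2) * shiftDensity u z := by
  simpa only [one_smul, one_mul] using shiftDensity_add_smul u z 1

lemma shiftDensity_le_shiftDensity_add_self (u z : E) :
    shiftDensity u z ≤ shiftDensity u (z + u) := by
  rw [shiftDensity_add_self]
  exact le_mul_of_one_le_left (shiftDensity_pos u z).le (Real.one_le_exp (sq_nonneg _))

lemma shiftDensity_rpow (u z : E) (s : ℝ) :
    shiftDensity u z ^ s = Real.exp (s * (s - 1) / 2 * ‖u‖ ^ 2) * shiftDensity (s • u) z := by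
  rw [shiftDensity, shiftDensity, ← Real.exp_mul, ← Real.exp_add, norm_smul, mul_pow,
    Real.norm_eq_abs, sq_abs, real_inner_smul_left]
  ring_nf

variable [FiniteDimensional ℝ E] [MeasurableSpace E] [BorelSpace E]

@[fun_prop]
lemma measurable_shiftDensity (u : E) : Measurable (shiftDensity u) := by
  unfold shiftDensity; fun_prop

open Complex in
lemma integral_cexp_inner_stdGaussian (u t : E) :
    ∫ z, cexp (⟪u, z⟫ + ⟪z, t⟫ * I) ∂(stdGaussian E)
      = cexp ((‖u‖ ^ 2 - ‖t‖ ^ 2) / 2 + ⟪u, t⟫ * I) := by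
  let e := stdOrthonormalBasis ℝ E
  have hprod : ∀ x : Fin (Module.finrank ℝ E) → ℝ,
      cexp (⟪u, ∑ i, x i • e i⟫ + ⟪∑ i, x i • e i, t⟫ * I)
        = ∏ i, cexp ((⟪u, e i⟫ + ⟪e i, t⟫ * I) * x i) := fun x => by
    rw [← exp_sum, inner_sum, sum_inner]
    push_cast
    rw [Finset.sum_mul, ← Finset.sum_add_distrib]
    congr 1
    refine Finset.sum_congr rfl fun i _ => ?_
    rw [real_inner_smul_left, real_inner_smul_right]
    push_cast
    ring
  have hcoord : ∀ w : ℂ, ∫ x : ℝ, cexp (w * x) ∂(gaussianReal 0 1) = cexp (w ^ 2 / 2) :=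
    fun w => by simpa [complexMGF] using complexMGF_id_gaussianReal (μ := 0) (v := 1) w
  have hsq : ∑ i, ((⟪u, e i⟫ : ℂ) + ⟪e i, t⟫ * I) ^ 2
      = ‖u‖ ^ 2 - ‖t‖ ^ 2 + 2 * ⟪u, t⟫ * I := by
    rw [← ofReal_pow, ← ofReal_pow, ← e.sum_sq_inner_left u, ← e.sum_sq_inner_right t,
      ← e.sum_inner_mul_inner u t]
    push_cast
    rw [Finset.mul_sum, Finset.sum_mul, ← Finset.sum_sub_distrib, ← Finset.sum_add_distrib]
    refine Finset.sum_congr rfl fun i _ => ?_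
    linear_combination (⟪e i, t⟫ : ℂ) ^ 2 * I_sq
  rw [stdGaussian_eq_map_pi_orthonormalBasis e, integral_map (Measurable.aemeasurable (by fun_prop))
    (Measurable.aestronglyMeasurable (by fun_prop))]
  simp_rw [hprod]
  rw [integral_fintype_prod_eq_prod
    (f := fun i (x : ℝ) => cexp ((⟪u, e i⟫ + ⟪e i, t⟫ * I) * x))]
  simp_rw [hcoord]
  rw [← exp_sum, ← Finset.sum_div, hsq]
  ring_nf

lemma integrable_exp_inner_stdGaussian (u : E) :
    Integrable (fun z => Real.exp ⟪u, z⟫) (stdGaussian E) := by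
  have hint : Integrable (fun z => Complex.exp ⟪u, z⟫) (stdGaussian E) := by
    refine not_imp_comm.1 integral_undef ?_
    have := integral_cexp_inner_stdGaussian u 0
    simp only [inner_zero_right, Complex.ofReal_zero, zero_mul, add_zero] at this
    rw [this]
    exact Complex.exp_ne_zero _
  simpa only [Complex.norm_exp_ofReal] using hint.norm

lemma stdGaussian_withDensity_shiftDensity (u : E) :
    (stdGaussian E).withDensity (fun z => ENNReal.ofReal (shiftDensity u z))
      = (stdGaussian E).map (· + u) := by
  have hint : Integrable (shiftDensity u) (stdGaussian E) := by
    unfold shiftDensity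
    simp_rw [Real.exp_sub]
    exact (integrable_exp_inner_stdGaussian u).div_const _
  have := isFiniteMeasure_withDensity_ofReal hint.2
  refine Measure.ext_of_charFun (funext fun t => ?_)
  have hdensity : ∀ z, (ENNReal.ofReal (shiftDensity u z)).toReal • Complex.exp (⟪z, t⟫ * Complex.I)
      = Complex.exp (-(‖u‖ : ℂ) ^ 2 / 2) * Complex.exp (⟪u, z⟫ + ⟪z, t⟫ * Complex.I) := fun z => by
    rw [ENNReal.toReal_ofReal (shiftDensity_pos _ _).le, Complex.real_smul, shiftDensity,
      Complex.ofReal_exp, ← Complex.exp_add, ← Complex.exp_add]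
    push_cast
    ring_nf
  rw [charFun_map_add_const, charFun_stdGaussian, charFun_apply,
    integral_withDensity_eq_integral_toReal_smul (by fun_prop) (by simp)]
  simp_rw [hdensity]
  rw [integral_const_mul, integral_cexp_inner_stdGaussian, ← Complex.exp_add, ← Complex.exp_add]
  ring_nf

lemma lintegral_add_stdGaussian (u : E) {g : E → ℝ≥0∞} (hg : Measurable g) :
    ∫⁻ z, g (z + u) ∂(stdGaussian E)
      = ∫⁻ z, ENNReal.ofReal (shiftDensity u z) * g z ∂(stdGaussian E) := by
  rw [← lintegral_map hg (measurable_add_const u), ← stdGaussian_withDensity_shiftDensity,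
    lintegral_withDensity_eq_lintegral_mul _ (by fun_prop) hg]
  rfl

lemma lintegral_shiftDensity_rpow (u : E) (s : ℝ) :
    ∫⁻ z, ENNReal.ofReal (shiftDensity u z ^ s) ∂(stdGaussian E)
      = ENNReal.ofReal (Real.exp (s * (s - 1) / 2 * ‖u‖ ^ 2)) := by
  have hone : ∫⁻ z, ENNReal.ofReal (shiftDensity (s • u) z) ∂(stdGaussian E) = 1 := by
    simpa using (lintegral_add_stdGaussian (s • u) (g := fun _ => 1) measurable_const).symm
  simp_rw [shiftDensity_rpow, ENNReal.ofReal_mul (Real.exp_pos _).le]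
  rw [lintegral_const_mul _ (by fun_prop), hone, mul_one]

end GaussianShift

/-! ### Moments of the density of the subsampled Gaussian law -/

lemma inv_pow_le_inv_pow_add {x y : ℝ} (hx : 0 < x) (hxy : x ≤ y) (n : ℕ) :
    x⁻¹ ^ n ≤ y⁻¹ ^ n + n * (y - x) * x⁻¹ ^ (n + 1) := by
  have hy : 0 < y := hx.trans_le hxy
  have hbernoulli : 1 + n * (x / y - 1) ≤ (x / y) ^ n :=
    one_add_mul_sub_le_pow (by linarith [div_pos hx hy]) n
  have hratio : (x - y) / x ≤ x / y - 1 := by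
    rw [div_sub_one hy.ne', div_le_div_iff₀ hx hy]
    nlinarith
  calc x⁻¹ ^ n = (1 + n * ((x - y) / x)) * x⁻¹ ^ n + n * (y - x) * x⁻¹ ^ (n + 1) := by
        rw [pow_succ, div_eq_mul_inv]
        ring
    _ ≤ (x / y) ^ n * x⁻¹ ^ n + n * (y - x) * x⁻¹ ^ (n + 1) := by
        gcongr
        exact hbernoulli.trans' (by gcongr)
    _ = y⁻¹ ^ n + n * (y - x) * x⁻¹ ^ (n + 1) := by
        rw [← mul_pow]
        congr 2
        field_simp

lemma exp_sub_one_le_two_mul {y : ℝ} (hy0 : 0 ≤ y) (hy1 : y ≤ 1) : Real.exp y - 1 ≤ 2 * y := by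
  simpa only [abs_of_nonneg hy0] using
    (le_abs_self _).trans (Real.abs_exp_sub_one_le ((abs_of_nonneg hy0).trans_le hy1))

lemma one_sub_add_mul_exp_le_exp {q y : ℝ} (hq : 0 ≤ q) (hy0 : 0 ≤ y) (hy1 : y ≤ 1) :
    1 - q + q * Real.exp y ≤ Real.exp (2 * q * y) := by
  calc 1 - q + q * Real.exp y = q * (Real.exp y - 1) + 1 := by ring
    _ ≤ q * (2 * y) + 1 := by
        gcongr
        exact exp_sub_one_le_two_mul hy0 hy1
    _ ≤ Real.exp (q * (2 * y)) := Real.add_one_le_exp _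
    _ = Real.exp (2 * q * y) := by ring_nf

section MixDensity

variable {E : Type*} [NormedAddCommGroup E] [InnerProductSpace ℝ E] {q : ℝ}

/-- The density at `z` of the mixture `(1 - q) N(0, I) + q N(u, I)` with respect to `N(0, I)`. -/
noncomputable def mixDensity (q : ℝ) (u z : E) : ℝ :=
  1 - q + q * shiftDensity u z

lemma mixDensity_pos (hq0 : 0 ≤ q) (hq1 : q ≤ 1) (u z : E) : 0 < mixDensity q u z := by
  have := shiftDensity_pos u z
  obtain rfl | hq := hq1.eq_or_lt
  · simpa [mixDensity] using this
  · have := sub_pos.2 hq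
    unfold mixDensity
    positivity

lemma half_le_mixDensity (hq0 : 0 ≤ q) (hq : q ≤ 1 / 2) (u z : E) : 1 / 2 ≤ mixDensity q u z := by
  have := mul_nonneg hq0 (shiftDensity_pos u z).le
  unfold mixDensity
  linarith

lemma mixDensity_le_mixDensity_add_self (hq0 : 0 ≤ q) (u z : E) :
    mixDensity q u z ≤ mixDensity q u (z + u) :=
  add_le_add_right (mul_le_mul_of_nonneg_left (shiftDensity_le_shiftDensity_add_self u z) hq0) _

lemma shiftDensity_rpow_le_mixDensity (hq0 : 0 ≤ q) (hq1 : q ≤ 1) (u z : E) :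
    shiftDensity u z ^ q ≤ mixDensity q u z := by
  simpa [mixDensity] using Real.geom_mean_le_arith_mean2_weighted (sub_nonneg.2 hq1) hq0
    zero_le_one (shiftDensity_pos u z).le (by ring)

variable [FiniteDimensional ℝ E] [MeasurableSpace E] [BorelSpace E]

@[fun_prop]
lemma measurable_mixDensity (q : ℝ) (u : E) : Measurable (mixDensity q u) := by
  unfold mixDensity; fun_prop

lemma lintegral_mixDensity_add_smul_mul (hq0 : 0 ≤ q) (hq1 : q ≤ 1) (u : E) (t : ℝ) {g : E → ℝ≥0∞}
    (hg : Measurable g) :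
    ∫⁻ z, ENNReal.ofReal (mixDensity q u (z + t • u)) * g z ∂(stdGaussian E)
      = ENNReal.ofReal (1 - q) * ∫⁻ z, g z ∂(stdGaussian E)
        + ENNReal.ofReal (q * Real.exp (t * ‖u‖ ^ 2)) * ∫⁻ z, g (z + u) ∂(stdGaussian E) := by
  have hqt : 0 ≤ q * Real.exp (t * ‖u‖ ^ 2) := by positivity
  rw [lintegral_add_stdGaussian u hg, ← lintegral_const_mul _ hg,
    ← lintegral_const_mul _ (by fun_prop), ← lintegral_add_left (by fun_prop)]
  refine lintegral_congr fun z => ?_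
  rw [mixDensity, shiftDensity_add_smul, ← mul_assoc, ENNReal.ofReal_add (sub_nonneg.2 hq1)
    (mul_nonneg hqt (shiftDensity_pos u z).le), ENNReal.ofReal_mul hqt]
  ring

-- Peeling off one factor of the power replaces the Gaussian law by a mixture with its translate by
-- `u`, which is why the induction has to run over all translates `z + t • u`.
lemma lintegral_mixDensity_add_smul_pow_le (hq0 : 0 ≤ q) (hq1 : q ≤ 1) (u : E) (k : ℕ) {t : ℝ}
    (ht : 0 ≤ t) (htk : (t + 2 * k) * ‖u‖ ^ 2 ≤ 1) :
    ∫⁻ z, ENNReal.ofReal (mixDensity q u (z + t • u) ^ k) ∂(stdGaussian E)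
      ≤ ENNReal.ofReal (Real.exp ((2 * q * t * k + 2 * q ^ 2 * k ^ 2) * ‖u‖ ^ 2)) := by
  induction k generalizing t with
  | zero => simp
  | succ k ih =>
    have hu := sq_nonneg ‖u‖
    push_cast at htk ⊢
    set y := (t + 2 * q * k) * ‖u‖ ^ 2 with hy
    have hy0 : 0 ≤ y := by positivity
    have hy1 : y ≤ 1 := hy ▸ htk.trans' (mul_le_mul_of_nonneg_right (by nlinarith) hu)
    have hsame := ih ht (by nlinarith)
    have hnext := ih (t := t + 1) (by linarith) (by nlinarith)
    set r := (2 * q * t * k + 2 * q ^ 2 * k ^ 2) * ‖u‖ ^ 2 with hr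
    have hexp : Real.exp (t * ‖u‖ ^ 2)
        * Real.exp ((2 * q * (t + 1) * k + 2 * q ^ 2 * k ^ 2) * ‖u‖ ^ 2)
          = Real.exp y * Real.exp r := by
      rw [← Real.exp_add, ← Real.exp_add, hy, hr]
      ring_nf
    have htranslate : ∀ z, z + u + t • u = z + (t + 1) • u := fun z => by
      rw [add_smul, one_smul, add_assoc, add_comm u]
    simp_rw [pow_succ', ENNReal.ofReal_mul (mixDensity_pos hq0 hq1 u _).le]
    rw [lintegral_mixDensity_add_smul_mul hq0 hq1 u t
      (g := fun z => ENNReal.ofReal (mixDensity q u (z + t • u) ^ k)) (by fun_prop)]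
    simp_rw [htranslate]
    grw [hsame, hnext, ← ENNReal.ofReal_mul (sub_nonneg.2 hq1),
      ← ENNReal.ofReal_mul (by positivity),
      ← ENNReal.ofReal_add (mul_nonneg (sub_nonneg.2 hq1) (Real.exp_pos _).le) (by positivity),
      mul_assoc q, hexp, ← mul_assoc, ← add_mul, one_sub_add_mul_exp_le_exp hq0 hy0 hy1,
      ← Real.exp_add]
    gcongr
    rw [hy, hr]
    nlinarith [mul_nonneg (sq_nonneg q) hu]

lemma lintegral_mixDensity_pow_le (hq0 : 0 ≤ q) (hq1 : q ≤ 1) (u : E) (k : ℕ)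
    (h : q = 1 ∨ 2 * k * ‖u‖ ^ 2 ≤ 1) :
    ∫⁻ z, ENNReal.ofReal (mixDensity q u z ^ k) ∂(stdGaussian E)
      ≤ ENNReal.ofReal (Real.exp (2 * k ^ 2 * q ^ 2 * ‖u‖ ^ 2)) := by
  obtain rfl | h := h
  · simp only [mixDensity, sub_self, zero_add, one_mul]
    simp_rw [← Real.rpow_natCast (shiftDensity u _)]
    rw [lintegral_shiftDensity_rpow]
    gcongr
    nlinarith [k.cast_nonneg (α := ℝ), sq_nonneg (k : ℝ)]
  · refine (le_of_eq ?_).trans ((lintegral_mixDensity_add_smul_pow_le hq0 hq1 u k le_rfl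
      (by simpa using h)).trans (le_of_eq ?_))
    · simp only [zero_smul, add_zero]
    · ring_nf

lemma lintegral_inv_mixDensity_add_self_pow_le (hq0 : 0 ≤ q) (hq : q ≤ 1 / 2) (u : E) (k : ℕ) :
    ∫⁻ z, ENNReal.ofReal ((mixDensity q u (z + u))⁻¹ ^ (k + 2)) ∂(stdGaussian E)
      ≤ 4 * ∫⁻ z, ENNReal.ofReal ((mixDensity q u z)⁻¹ ^ k) ∂(stdGaussian E) := by
  rw [← lintegral_const_mul _ (by fun_prop)]
  refine lintegral_mono fun z => ?_
  have hpos := mixDensity_pos hq0 (by linarith) u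
  have hinv : (mixDensity q u (z + u))⁻¹ ≤ 2 := by
    simpa using inv_anti₀ one_half_pos (half_le_mixDensity hq0 hq u (z + u))
  rw [← ENNReal.ofReal_ofNat, ← ENNReal.ofReal_mul (by norm_num)]
  refine ENNReal.ofReal_le_ofReal ?_
  calc (mixDensity q u (z + u))⁻¹ ^ (k + 2)
      = (mixDensity q u (z + u))⁻¹ ^ 2 * (mixDensity q u (z + u))⁻¹ ^ k := by ring
    _ ≤ 2 ^ 2 * (mixDensity q u z)⁻¹ ^ k := by
        have := hpos (z + u)
        have := hpos z
        gcongr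
        exact mixDensity_le_mixDensity_add_self hq0 u z
    _ = 4 * (mixDensity q u z)⁻¹ ^ k := by norm_num

lemma lintegral_inv_mixDensity_pow_le_add_self (hq0 : 0 ≤ q) (hq1 : q ≤ 1) (u : E) (k : ℕ) :
    ∫⁻ z, ENNReal.ofReal ((mixDensity q u z)⁻¹ ^ k) ∂(stdGaussian E)
      ≤ ∫⁻ z, ENNReal.ofReal ((mixDensity q u (z + u))⁻¹ ^ k) ∂(stdGaussian E)
        + ENNReal.ofReal (k * q * (Real.exp (‖u‖ ^ 2) - 1))
          * ∫⁻ z, ENNReal.ofReal ((mixDensity q u (z + u))⁻¹ ^ (k + 1)) ∂(stdGaussian E) := by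
  have hc : 0 ≤ k * q * (Real.exp (‖u‖ ^ 2) - 1) := by
    have := sub_nonneg.2 (Real.one_le_exp (sq_nonneg ‖u‖))
    positivity
  rw [lintegral_add_stdGaussian u (g := fun z => ENNReal.ofReal ((mixDensity q u z)⁻¹ ^ (k + 1)))
    (by fun_prop), ← lintegral_const_mul _ (by fun_prop), ← lintegral_add_left (by fun_prop)]
  refine lintegral_mono fun z => ?_
  have hW := mixDensity_pos hq0 hq1 u
  have hS := (shiftDensity_pos u z).le
  have hWz := (inv_pos.2 (hW z)).le
  have hdiff : mixDensity q u (z + u) - mixDensity q u z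
      = q * (Real.exp (‖u‖ ^ 2) - 1) * shiftDensity u z := by
    rw [mixDensity, mixDensity, shiftDensity_add_self]
    ring
  have hWzu := (inv_pos.2 (hW (z + u))).le
  rw [← ENNReal.ofReal_mul hS, ← ENNReal.ofReal_mul hc, ← ENNReal.ofReal_add (by positivity)
    (by positivity)]
  refine ENNReal.ofReal_le_ofReal ((inv_pow_le_inv_pow_add (hW z)
    (mixDensity_le_mixDensity_add_self hq0 u z) k).trans (le_of_eq ?_))
  rw [hdiff]
  ring

lemma lintegral_inv_mixDensity_pow_succ_add (hq0 : 0 ≤ q) (hq1 : q ≤ 1) (u : E) (k : ℕ) :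
    ENNReal.ofReal (1 - q)
          * ∫⁻ z, ENNReal.ofReal ((mixDensity q u z)⁻¹ ^ (k + 1)) ∂(stdGaussian E)
        + ENNReal.ofReal q
          * ∫⁻ z, ENNReal.ofReal ((mixDensity q u (z + u))⁻¹ ^ (k + 1)) ∂(stdGaussian E)
      = ∫⁻ z, ENNReal.ofReal ((mixDensity q u z)⁻¹ ^ k) ∂(stdGaussian E) := by
  have hmul := lintegral_mixDensity_add_smul_mul hq0 hq1 u 0
    (g := fun z => ENNReal.ofReal ((mixDensity q u z)⁻¹ ^ (k + 1))) (by fun_prop)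
  simp only [zero_smul, add_zero, zero_mul, Real.exp_zero, mul_one] at hmul
  rw [← hmul]
  refine lintegral_congr fun z => ?_
  have hW := mixDensity_pos hq0 hq1 u z
  rw [← ENNReal.ofReal_mul hW.le, pow_succ', mul_inv_cancel_left₀ hW.ne']

lemma lintegral_inv_mixDensity_pow_succ_le (hq0 : 0 ≤ q) (hq : q ≤ 1 / 2) (u : E)
    (hu : ‖u‖ ^ 2 ≤ 1) (k : ℕ) :
    ∫⁻ z, ENNReal.ofReal ((mixDensity q u z)⁻¹ ^ (k + 1)) ∂(stdGaussian E)
      ≤ ENNReal.ofReal (Real.exp (8 * (k + 1) * q ^ 2 * ‖u‖ ^ 2))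
        * ∫⁻ z, ENNReal.ofReal ((mixDensity q u z)⁻¹ ^ k) ∂(stdGaussian E) := by
  have hq1 : q ≤ 1 := by linarith
  set A := ∫⁻ z, ENNReal.ofReal ((mixDensity q u z)⁻¹ ^ (k + 1)) ∂(stdGaussian E)
  set B := ∫⁻ z, ENNReal.ofReal ((mixDensity q u (z + u))⁻¹ ^ (k + 1)) ∂(stdGaussian E)
  set C := ∫⁻ z, ENNReal.ofReal ((mixDensity q u z)⁻¹ ^ k) ∂(stdGaussian E)
  set r := (k + 1) * q * (Real.exp (‖u‖ ^ 2) - 1)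
  have hr : 0 ≤ r := by
    have := sub_nonneg.2 (Real.one_le_exp (sq_nonneg ‖u‖))
    positivity
  have hpeel : ENNReal.ofReal (1 - q) * A + ENNReal.ofReal q * B = C :=
    lintegral_inv_mixDensity_pow_succ_add hq0 hq1 u k
  have hcompare : A ≤ B + ENNReal.ofReal r * (4 * C) := by
    have := lintegral_inv_mixDensity_pow_le_add_self hq0 hq1 u (k + 1)
    push_cast at this
    exact this.trans (add_le_add_right (mul_le_mul_right
      (lintegral_inv_mixDensity_add_self_pow_le hq0 hq u k) _) _)
  calc A = ENNReal.ofReal (1 - q) * A + ENNReal.ofReal q * A := by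
        rw [← add_mul, ← ENNReal.ofReal_add (sub_nonneg.2 hq1) hq0, sub_add_cancel,
          ENNReal.ofReal_one, one_mul]
    _ ≤ ENNReal.ofReal (1 - q) * A + ENNReal.ofReal q * (B + ENNReal.ofReal r * (4 * C)) := by
        gcongr
    _ = (ENNReal.ofReal (1 - q) * A + ENNReal.ofReal q * B)
          + ENNReal.ofReal q * ENNReal.ofReal r * 4 * C := by ring
    _ = ENNReal.ofReal (1 + q * r * 4) * C := by
        rw [hpeel, ENNReal.ofReal_add zero_le_one (by positivity),
          ENNReal.ofReal_mul (p := q * r) (by positivity), ENNReal.ofReal_mul hq0,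
          ENNReal.ofReal_one, ENNReal.ofReal_ofNat]
        ring
    _ ≤ ENNReal.ofReal (Real.exp (8 * (k + 1) * q ^ 2 * ‖u‖ ^ 2)) * C := by
        gcongr
        calc 1 + q * r * 4 = 4 * (k + 1) * q ^ 2 * (Real.exp (‖u‖ ^ 2) - 1) + 1 := by ring
          _ ≤ 4 * (k + 1) * q ^ 2 * (2 * ‖u‖ ^ 2) + 1 := by
              gcongr
              exact exp_sub_one_le_two_mul (sq_nonneg _) hu
          _ ≤ Real.exp (8 * (k + 1) * q ^ 2 * ‖u‖ ^ 2) :=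
              (Real.add_one_le_exp _).trans_eq (by ring_nf)

lemma lintegral_inv_mixDensity_pow_le_of_le_half (hq0 : 0 ≤ q) (hq : q ≤ 1 / 2) (u : E)
    (hu : ‖u‖ ^ 2 ≤ 1) (k : ℕ) :
    ∫⁻ z, ENNReal.ofReal ((mixDensity q u z)⁻¹ ^ k) ∂(stdGaussian E)
      ≤ ENNReal.ofReal (Real.exp (4 * (k * (k + 1)) * q ^ 2 * ‖u‖ ^ 2)) := by
  induction k with
  | zero => simp
  | succ k ih =>
    refine (lintegral_inv_mixDensity_pow_succ_le hq0 hq u hu k).trans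
      ((mul_le_mul_right ih _).trans (le_of_eq ?_))
    rw [← ENNReal.ofReal_mul (Real.exp_pos _).le, ← Real.exp_add]
    push_cast
    ring_nf

lemma lintegral_inv_mixDensity_pow_le_of_half_le (hq0 : 1 / 2 ≤ q) (hq1 : q ≤ 1) (u : E) (k : ℕ) :
    ∫⁻ z, ENNReal.ofReal ((mixDensity q u z)⁻¹ ^ k) ∂(stdGaussian E)
      ≤ ENNReal.ofReal (Real.exp (k * q * (k * q + 1) / 2 * ‖u‖ ^ 2)) := by
  have hq : 0 ≤ q := by linarith
  calc ∫⁻ z, ENNReal.ofReal ((mixDensity q u z)⁻¹ ^ k) ∂(stdGaussian E)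
      ≤ ∫⁻ z, ENNReal.ofReal (shiftDensity u z ^ (-(k * q))) ∂(stdGaussian E) := by
        refine lintegral_mono fun z => ENNReal.ofReal_le_ofReal ?_
        have hS := shiftDensity_pos u z
        rw [Real.rpow_neg hS.le, mul_comm, Real.rpow_mul_natCast hS.le, inv_pow]
        gcongr
        exact shiftDensity_rpow_le_mixDensity hq hq1 u z
    _ = ENNReal.ofReal (Real.exp (k * q * (k * q + 1) / 2 * ‖u‖ ^ 2)) := by
        rw [lintegral_shiftDensity_rpow]
        ring_nf

lemma lintegral_inv_mixDensity_pow_le (hq0 : 0 ≤ q) (hq1 : q ≤ 1) (u : E) (k : ℕ)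
    (h : 1 / 2 ≤ q ∨ ‖u‖ ^ 2 ≤ 1) :
    ∫⁻ z, ENNReal.ofReal ((mixDensity q u z)⁻¹ ^ k) ∂(stdGaussian E)
      ≤ ENNReal.ofReal (Real.exp (8 * k ^ 2 * q ^ 2 * ‖u‖ ^ 2)) := by
  have hkk : (k : ℝ) ≤ k ^ 2 := by exact_mod_cast Nat.le_self_pow two_ne_zero k
  by_cases hq : 1 / 2 ≤ q
  · refine (lintegral_inv_mixDensity_pow_le_of_half_le hq hq1 u k).trans ?_
    gcongr
    nlinarith [k.cast_nonneg (α := ℝ), mul_le_mul_of_nonneg_right hkk hq0,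
      mul_nonneg (mul_nonneg (sq_nonneg (k : ℝ)) hq0) (sub_nonneg.2 hq)]
  · refine (lintegral_inv_mixDensity_pow_le_of_le_half hq0 (not_le.1 hq).le u
      (h.resolve_left hq) k).trans ?_
    have hle : 4 * ((k : ℝ) * (k + 1)) ≤ 8 * k ^ 2 := by linarith
    gcongr

end MixDensity

section SubsampledGaussian

variable {d : ℕ} {q : unitInterval}

lemma lintegral_bernoulliMeasure_bool (q : unitInterval) (g : Bool → ℝ≥0∞) :
    ∫⁻ B, g B ∂(bernoulliMeasure true false q)
      = ENNReal.ofReal q * g true + ENNReal.ofReal (1 - q) * g false := by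
  rw [bernoulliMeasure_def, lintegral_add_measure]
  simp only [lintegral_smul_measure, lintegral_dirac, ENNReal.smul_def, smul_eq_mul]
  congr 2
  · rw [ENNReal.ofReal, Real.toNNReal_of_nonneg q.2.1]; rfl
  · rw [ENNReal.ofReal, Real.toNNReal_of_nonneg (sub_nonneg.2 q.2.2)]; rfl

lemma lintegral_noiseLaw {σ : ℝ} (hσ : σ ≠ 0) (a : Vec d) {g : Vec d → ℝ≥0∞}
    (hg : Measurable g) :
    ∫⁻ ξ, g (a + ξ) ∂(noiseLaw d σ)
      = ∫⁻ z, ENNReal.ofReal (shiftDensity (σ⁻¹ • a) z) * g (σ • z) ∂(stdGaussian (Vec d)) := by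
  rw [noiseLaw, lintegral_map (by fun_prop) (by fun_prop),
    ← lintegral_add_stdGaussian (σ⁻¹ • a) (g := fun z => g (σ • z)) (by fun_prop)]
  simp_rw [smul_add, smul_inv_smul₀ hσ, add_comm a]

/-- The subsampled Gaussian mechanism: the law of `a + B u + ξ`, for an independent Bernoulli
variable `B` with parameter `q` and a Gaussian vector `ξ` with law `N(0, σ² I)`. -/
noncomputable def subsampledLaw (q : unitInterval) (σ : ℝ) (a u : Vec d) : Measure (Vec d) :=
  ((bernoulliMeasure true false q).prod (noiseLaw d σ)).map
    fun y => a + (if y.1 then u else 0) + y.2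

lemma measurable_add_ite_add {Ω : Type*} [MeasurableSpace Ω] {a ξ : Ω → Vec d} {B : Ω → Bool}
    (ha : Measurable a) (hB : Measurable B) (hξ : Measurable ξ) (u : Vec d) :
    Measurable fun ω => a ω + (if B ω then u else 0) + ξ ω :=
  (ha.add (.ite (hB (measurableSet_singleton true)) measurable_const measurable_const)).add hξ

lemma subsampledLaw_eq_map_withDensity (q : unitInterval) {σ : ℝ} (hσ : σ ≠ 0) (a u : Vec d) :
    subsampledLaw q σ a u
      = ((stdGaussian (Vec d)).withDensity fun z =>
          ENNReal.ofReal (mixDensity q (σ⁻¹ • u) z)).map fun z => a + σ • z := by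
  have hmeas := measurable_add_ite_add (measurable_const (a := a))
    (measurable_fst (α := Bool) (β := Vec d)) measurable_snd u
  refine Measure.ext_of_lintegral _ fun g hg => ?_
  have hgmeas : Measurable fun y : Bool × Vec d => g (a + (if y.1 then u else 0) + y.2) :=
    hg.comp hmeas
  rw [subsampledLaw, lintegral_map hg hmeas, lintegral_prod _ hgmeas.aemeasurable,
    lintegral_bernoulliMeasure_bool, lintegral_map hg (by fun_prop),
    lintegral_withDensity_eq_lintegral_mul _ (by fun_prop) (by fun_prop)]
  simp only [if_true, Bool.false_eq_true, if_false, add_assoc, Pi.mul_apply]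
  rw [lintegral_noiseLaw hσ u (g := fun ξ => g (a + ξ)) (by fun_prop),
    lintegral_noiseLaw hσ 0 (g := fun ξ => g (a + ξ)) (by fun_prop),
    ← lintegral_const_mul _ (by fun_prop), ← lintegral_const_mul _ (by fun_prop),
    ← lintegral_add_left (by fun_prop)]
  refine lintegral_congr fun z => ?_
  rw [smul_zero, shiftDensity_zero_left, mixDensity, add_comm (1 - (q : ℝ)),
    ENNReal.ofReal_add (mul_nonneg q.2.1 (shiftDensity_pos _ _).le) (sub_nonneg.2 q.2.2),
    ENNReal.ofReal_mul q.2.1, ENNReal.ofReal_one]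
  ring

lemma holderDominated_subsampledLaw {σ v : ℝ} (hσ : σ ≠ 0) (a : Vec d) {u u' : Vec d}
    (hu : ‖σ⁻¹ • u‖ ^ 2 ≤ v) (hu' : ‖σ⁻¹ • u'‖ ^ 2 ≤ v) {α : ℕ} (hα : 2 ≤ α)
    (h : (q : ℝ) = 1 ∨ 4 * α * v ≤ 1) :
    HolderDominated (α / (α - 1)) (ENNReal.ofReal (Real.exp (20 * α * (q : ℝ) ^ 2 * v)))
      (subsampledLaw q σ a u) (subsampledLaw q σ a u') := by
  have hα' : (2 : ℝ) ≤ α := by exact_mod_cast hα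
  have hpos : ∀ w z : Vec d, 0 < mixDensity q w z := mixDensity_pos q.2.1 q.2.2
  have hP := lintegral_mixDensity_pow_le q.2.1 q.2.2 (σ⁻¹ • u) (2 * α)
    (h.imp_right fun h => by push_cast; nlinarith)
  have hQ := lintegral_inv_mixDensity_pow_le q.2.1 q.2.2 (σ⁻¹ • u') (2 * (α - 1))
    (h.imp (fun h => by linarith) fun h => by nlinarith)
  simp_rw [fun z => ENNReal.ofReal_pow (hpos (σ⁻¹ • u) z).le,
    fun z => ENNReal.ofReal_pow (inv_pos.2 (hpos (σ⁻¹ • u') z)).le,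
    fun z => ENNReal.ofReal_inv_of_pos (hpos (σ⁻¹ • u') z)] at hP hQ
  have hdom := (HolderDominated.withDensity_of_moments hα (by fun_prop) (by fun_prop)
    (fun z => (ENNReal.ofReal_pos.2 (hpos _ z)).ne') (fun _ => ENNReal.ofReal_ne_top) hP hQ).map
      (f := fun z => a + σ • z) (by fun_prop)
  rw [← subsampledLaw_eq_map_withDensity q hσ, ← subsampledLaw_eq_map_withDensity q hσ,
    ← ENNReal.ofReal_mul (Real.exp_pos _).le, ← Real.exp_add,
    ENNReal.ofReal_rpow_of_pos (Real.exp_pos _), ← Real.exp_mul] at hdom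
  refine hdom.mono (ENNReal.ofReal_le_ofReal (Real.exp_le_exp.2 ?_))
  have hsub : ((α - 1 : ℕ) : ℝ) ≤ α := by exact_mod_cast α.sub_le 1
  push_cast
  calc (2 * (2 * α) ^ 2 * (q : ℝ) ^ 2 * ‖σ⁻¹ • u‖ ^ 2
          + 8 * (2 * (α - 1 : ℕ)) ^ 2 * (q : ℝ) ^ 2 * ‖σ⁻¹ • u'‖ ^ 2) * (1 / (2 * α))
      ≤ (2 * (2 * α) ^ 2 * (q : ℝ) ^ 2 * v + 8 * (2 * α) ^ 2 * (q : ℝ) ^ 2 * v)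
          * (1 / (2 * α)) := by gcongr
    _ = 20 * α * (q : ℝ) ^ 2 * v := by field_simp; ring

end SubsampledGaussian

/-! ### Privacy of the transcript -/

section Privacy

variable {Z : Type*} {d n m : ℕ} {ω : ℝ} {f : Z → Vec d → ℝ}

/-- The probability `b / m` with which a sample enters a minibatch, capped at `1`. -/
noncomputable def inclusionProb (b m : ℕ) : unitInterval :=
  Set.projIcc (0 : ℝ) 1 zero_le_one ((b : ℝ) / (m : ℝ))

lemma coe_inclusionProb {b m : ℕ} (hbm : b ≤ m) : (inclusionProb b m : ℝ) = b / m := by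
  have hle : (b : ℝ) / m ≤ 1 := div_le_one_of_le₀ (by exact_mod_cast hbm) (Nat.cast_nonneg m)
  rw [inclusionProb, Set.projIcc_of_mem _ ⟨by positivity, hle⟩]

lemma map_update_minibatchLaw_prod (b : ℕ) (j : Fin m) :
    ((minibatchLaw b m).prod (bernoulliMeasure true false (inclusionProb b m))).map
      (fun p => Function.update p.1 j p.2) = minibatchLaw b m := by
  rw [minibatchLaw, map_update_pi_prod]
  exact congrArg Measure.pi (Function.update_eq_self j _)

lemma stochGrad_update (f : Z → Vec d → ℝ) (D : Fin m → Z) (b : ℕ) (x : Vec d)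
    (S : Fin m → Bool) (j : Fin m) (B : Bool) :
    stochGrad f D b x (Function.update S j B) = stochGrad f D b x (Function.update S j false)
      + if B then (1 / (b : ℝ)) • gradient (f (D j)) x else 0 := by
  cases B
  · simp
  · rw [if_pos rfl, stochGrad, stochGrad, ← smul_add,
      ← Finset.sum_erase_add _ _ (Finset.mem_univ j),
      ← Finset.sum_erase_add Finset.univ _ (Finset.mem_univ j)]
    simp only [Function.update_self, if_true, Bool.false_eq_true, if_false, add_zero]
    congr 2
    refine Finset.sum_congr rfl fun k hk => ?_
    simp only [Function.update_of_ne (Finset.ne_of_mem_erase hk)]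

lemma stochGrad_update_false_congr {D D' : Fin m → Z} {j : Fin m} (h : ∀ k, k ≠ j → D k = D' k)
    (b : ℕ) (x : Vec d) (S : Fin m → Bool) :
    stochGrad f D b x (Function.update S j false)
      = stochGrad f D' b x (Function.update S j false) := by
  refine congrArg _ (Finset.sum_congr rfl fun k _ => ?_)
  obtain rfl | hk := eq_or_ne k j
  · simp
  · rw [h k hk]

lemma perturbedGradKernel_apply (f : Z → Vec d → ℝ) (D : Fin m → Z) (b : ℕ) (σ : ℝ) (x : Vec d) :
    perturbedGradKernel f D b σ x = ((minibatchLaw b m).prod (noiseLaw d σ)).map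
      fun p => stochGrad f D b x p.1 + p.2 :=
  map_id_prod_const_apply _ (measurable_perturbedGrad f D b) x

-- Drawing the membership of the sample `j` again does not change the law of the minibatch.
lemma perturbedGradKernel_apply_eq_map_resample (f : Z → Vec d → ℝ) (D : Fin m → Z) (b : ℕ) (σ : ℝ)
    (x : Vec d) (j : Fin m) :
    perturbedGradKernel f D b σ x =
      ((minibatchLaw b m).prod
        ((bernoulliMeasure true false (inclusionProb b m)).prod (noiseLaw d σ))).map
        fun p => stochGrad f D b x (Function.update p.1 j false)
          + (if p.2.1 then (1 / (b : ℝ)) • gradient (f (D j)) x else 0) + p.2.2 := by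
  have hresample : MeasurePreserving (fun p : (Fin m → Bool) × Bool => Function.update p.1 j p.2)
      ((minibatchLaw b m).prod (bernoulliMeasure true false (inclusionProb b m)))
      (minibatchLaw b m) := ⟨measurable_update', map_update_minibatchLaw_prod b j⟩
  have hpres := (hresample.prod (MeasurePreserving.id (noiseLaw d σ))).comp
    (measurePreserving_prodAssoc (minibatchLaw b m)
      (bernoulliMeasure true false (inclusionProb b m)) (noiseLaw d σ)).symm
  have hgrad : Measurable fun p : (Fin m → Bool) × Vec d => stochGrad f D b x p.1 + p.2 :=
    ((measurable_of_finite (stochGrad f D b x)).comp measurable_fst).add measurable_snd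
  rw [perturbedGradKernel_apply, ← hpres.map_eq, Measure.map_map hgrad hpres.measurable]
  congr 1
  funext p
  exact congrArg (· + p.2.2) (stochGrad_update f D b x p.1 j p.2.1)

lemma holderDominated_perturbedGradKernel {G : ℝ} (hG : ∀ z, HasBoundedGradient G (f z))
    {D D' : Fin m → Z} (hD : Neighbors D D') {b : ℕ} (hb : 1 ≤ b) (hbm : b ≤ m) {σ : ℝ}
    (hσ : 0 < σ) {α : ℕ} (hα : 2 ≤ α) (h : b = m ∨ 4 * α * (G / (b * σ)) ^ 2 ≤ 1) (x : Vec d) :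
    HolderDominated (α / (α - 1)) (ENNReal.ofReal (Real.exp (20 * α * (G / (m * σ)) ^ 2)))
      (perturbedGradKernel f D b σ x) (perturbedGradKernel f D' b σ x) := by
  obtain ⟨j, hj⟩ := hD
  have hb0 : (0 : ℝ) < b := by exact_mod_cast hb
  have hm0 : (0 : ℝ) < m := hb0.trans_le (by exact_mod_cast hbm)
  have hp : 1 < (α : ℝ) / (α - 1) :=
    (Real.HolderConjugate.conjExponent (by exact_mod_cast hα)).symm.lt
  have hq := coe_inclusionProb hbm
  have hmeas : ∀ w : Vec d, Measurable fun p : (Fin m → Bool) × Bool × Vec d =>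
      stochGrad f D' b x (Function.update p.1 j false) + (if p.2.1 then w else 0) + p.2.2 :=
    measurable_add_ite_add ((measurable_of_finite fun S : Fin m → Bool =>
      stochGrad f D' b x (Function.update S j false)).comp measurable_fst)
      (measurable_fst.comp measurable_snd) (measurable_snd.comp measurable_snd)
  have hshift : ∀ z, ‖σ⁻¹ • (1 / (b : ℝ)) • gradient (f z) x‖ ^ 2 ≤ (G / (b * σ)) ^ 2 := fun z => by
    rw [norm_smul, norm_smul, Real.norm_of_nonneg (by positivity),
      Real.norm_of_nonneg (by positivity)]
    calc (σ⁻¹ * (1 / b * ‖gradient (f z) x‖)) ^ 2 ≤ (σ⁻¹ * (1 / b * G)) ^ 2 := by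
          gcongr
          exact hG z x
      _ = (G / (b * σ)) ^ 2 := by field_simp
  have hexp : 20 * α * (inclusionProb b m : ℝ) ^ 2 * (G / (b * σ)) ^ 2
      = 20 * α * (G / (m * σ)) ^ 2 := by
    rw [hq]
    field_simp
  rw [perturbedGradKernel_apply_eq_map_resample f D b σ x j,
    perturbedGradKernel_apply_eq_map_resample f D' b σ x j, ← hexp]
  simp only [stochGrad_update_false_congr hj]
  refine HolderDominated.map_prod hp (hmeas _) (hmeas _) fun S => ?_
  have hdom := holderDominated_subsampledLaw (q := inclusionProb b m) hσ.ne'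
    (stochGrad f D' b x (Function.update S j false)) (hshift (D j)) (hshift (D' j)) hα
    (h.imp_left fun h => by rw [hq, h, div_self hm0.ne'])
  exact hdom

lemma roundKernel_apply (D : Fin n → Fin m → Z) (b : ℕ) (σ : ℝ) (C : Fin n → Compressor d ω)
    (x : Vec d) : roundKernel f D b σ C x = Measure.pi fun i => messageKernel f (D i) b σ (C i) x :=
  rfl

lemma measurable_snoc (t : ℕ) {E : Type*} [MeasurableSpace E] :
    Measurable fun p : (Fin t → E) × E =>
      (Fin.snoc (α := fun _ => E) p.1 p.2 : Fin (t + 1) → E) := by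
  refine measurable_pi_lambda _ fun i => ?_
  induction i using Fin.lastCases with
  | last => simpa only [Fin.snoc_last] using measurable_snd
  | cast i => simp only [Fin.snoc_castSucc]; fun_prop

instance isProbabilityMeasure_transcriptLaw (f : Z → Vec d → ℝ) (D : Fin n → Fin m → Z) (b : ℕ)
    (η : ℕ → ℝ) (σ : ℝ) (C : ℕ → Fin n → Compressor d ω) (x0 : Vec d) (T : ℕ) :
    IsProbabilityMeasure (transcriptLaw f D b η σ C x0 T) := by
  induction T with
  | zero => rw [transcriptLaw]; infer_instance
  | succ t ih =>
    rw [transcriptLaw]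
    exact Measure.isProbabilityMeasure_map (measurable_snoc t).aemeasurable

lemma holderDominated_roundKernel {p : ℝ} (hp : 1 < p) {c : ℝ≥0∞} {D D' : Fin n → Fin m → Z}
    {b : ℕ} {σ : ℝ} {i : Fin n} (hne : ∀ k, k ≠ i → D k = D' k)
    (h : ∀ x, HolderDominated p c (perturbedGradKernel f (D i) b σ x)
      (perturbedGradKernel f (D' i) b σ x)) (C : Fin n → Compressor d ω) (x : Vec d) :
    HolderDominated p c (roundKernel f D b σ C x) (roundKernel f D' b σ C x) := by
  rw [roundKernel_apply, roundKernel_apply]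
  refine HolderDominated.pi hp i (fun k hk => by rw [hne k hk]) ?_
  rw [messageKernel, messageKernel, Kernel.comp_apply, Kernel.comp_apply, ← mul_one c]
  exact (h x).bind hp fun y => .refl hp _

lemma holderDominated_transcriptLaw {p : ℝ} (hp : 1 < p) {c : ℝ≥0∞} {D D' : Fin n → Fin m → Z}
    {b : ℕ} {σ : ℝ} {i : Fin n} (hne : ∀ k, k ≠ i → D k = D' k)
    (h : ∀ x, HolderDominated p c (perturbedGradKernel f (D i) b σ x)
      (perturbedGradKernel f (D' i) b σ x)) (η : ℕ → ℝ) (C : ℕ → Fin n → Compressor d ω)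
    (x0 : Vec d) (T : ℕ) :
    HolderDominated p (c ^ T) (transcriptLaw f D b η σ C x0 T)
      (transcriptLaw f D' b η σ C x0 T) := by
  induction T with
  | zero => simpa only [transcriptLaw, pow_zero] using HolderDominated.refl hp _
  | succ t ih =>
    rw [transcriptLaw, transcriptLaw, pow_succ]
    refine (ih.compProd hp fun s => ?_).map (measurable_snoc t)
    rw [Kernel.comap_apply, Kernel.comap_apply]
    exact holderDominated_roundKernel hp hne h _ _

lemma isLDP_transcriptLaw {G : ℝ} (hG : ∀ z, HasBoundedGradient G (f z)) {b : ℕ} (hb : 1 ≤ b)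
    (hbm : b ≤ m) {σ : ℝ} (hσ : 0 < σ) {α : ℕ} (hα : 2 ≤ α)
    (h : b = m ∨ 4 * α * (G / (b * σ)) ^ 2 ≤ 1) {ε δ : ℝ} (hδ : 0 < δ) (T : ℕ)
    (hT : 20 * α ^ 2 * (G / (m * σ)) ^ 2 * T ≤ ε * (α - 1) - Real.log (1 / δ))
    (η : ℕ → ℝ) (C : ℕ → Fin n → Compressor d ω) (x0 : Vec d) (D : Fin n → Fin m → Z) (i : Fin n) :
    IsLDP ε δ fun Di : Fin m → Z => transcriptLaw f (Function.update D i Di) b η σ C x0 T := by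
  intro Di Di' hD S hS
  have hα1 : (1 : ℝ) < α := by exact_mod_cast hα
  have hp : 1 < (α : ℝ) / (α - 1) := (Real.HolderConjugate.conjExponent hα1).symm.lt
  have hdom := holderDominated_transcriptLaw hp (f := f) (D := Function.update D i Di)
    (D' := Function.update D i Di') (b := b) (σ := σ) (i := i)
    (fun k hk => by simp only [Function.update_of_ne hk]) (fun x => by
      simpa only [Function.update_self] using
        holderDominated_perturbedGradKernel hG hD hb hbm hσ hα h x) η C x0 T
  rw [← ENNReal.ofReal_pow (Real.exp_pos _).le] at hdom
  refine hdom.measure_le hp hδ ?_ hS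
  rw [← Real.exp_nat_mul, Real.rpow_def_of_pos hδ, ← Real.exp_add, Real.exp_le_exp]
  rw [one_div, Real.log_inv] at hT
  calc T * (20 * α * (G / (m * σ)) ^ 2) = 20 * α ^ 2 * (G / (m * σ)) ^ 2 * T / α := by field_simp
    _ ≤ (ε * (α - 1) - -Real.log δ) / α := by gcongr
    _ = ε * (1 / (α / (α - 1))) + Real.log δ * (1 - 1 / (α / (α - 1))) := by
        rw [one_div_div]
        field_simp
        ring

end Privacy

/-! ### Means and variances of random vectors -/

lemma integral_norm_add_sq {Ω E : Type*} [MeasurableSpace Ω] [NormedAddCommGroup E]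
    [InnerProductSpace ℝ E] {μ : Measure Ω} {X Y : Ω → E} (hX : Integrable (fun x => ‖X x‖ ^ 2) μ)
    (hXY : Integrable (fun x => ⟪X x, Y x⟫) μ) (hY : Integrable (fun x => ‖Y x‖ ^ 2) μ) :
    ∫ x, ‖X x + Y x‖ ^ 2 ∂μ
      = ∫ x, ‖X x‖ ^ 2 ∂μ + 2 * ∫ x, ⟪X x, Y x⟫ ∂μ + ∫ x, ‖Y x‖ ^ 2 ∂μ := by
  simp_rw [norm_add_sq_real]
  rw [integral_add (hX.fun_add (hXY.const_mul 2)) hY, integral_add hX (hXY.const_mul 2),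
    integral_const_mul]

/-- The square integrable random vector `X` has mean `a` and variance `E‖X - a‖²` at most `V`. -/
structure HasMeanVarLE {Ω E : Type*} [MeasurableSpace Ω] [NormedAddCommGroup E] [NormedSpace ℝ E]
    (μ : Measure Ω) (X : Ω → E) (a : E) (V : ℝ) : Prop where
  memLp : MemLp X 2 μ
  integral_eq : ∫ x, X x ∂μ = a
  integral_sq_sub_le : ∫ x, ‖X x - a‖ ^ 2 ∂μ ≤ V

namespace HasMeanVarLE

variable {Ω Ω' E : Type*} [MeasurableSpace Ω] [MeasurableSpace Ω'] [NormedAddCommGroup E]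

section NormedSpace

variable [NormedSpace ℝ E] {μ : Measure Ω} {X : Ω → E} {a : E} {V : ℝ}

lemma nonneg (h : HasMeanVarLE μ X a V) : 0 ≤ V :=
  (integral_nonneg fun _ => sq_nonneg _).trans h.integral_sq_sub_le

lemma mono {V' : ℝ} (h : HasMeanVarLE μ X a V) (hV : V ≤ V') : HasMeanVarLE μ X a V' :=
  ⟨h.memLp, h.integral_eq, h.integral_sq_sub_le.trans hV⟩

lemma const_smul (h : HasMeanVarLE μ X a V) (c : ℝ) :
    HasMeanVarLE μ (fun x => c • X x) (c • a) (c ^ 2 * V) := by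
  refine ⟨h.memLp.const_smul c, by rw [integral_smul, h.integral_eq], ?_⟩
  simp_rw [← smul_sub, norm_smul, mul_pow, Real.norm_eq_abs, sq_abs, integral_const_mul]
  exact mul_le_mul_of_nonneg_left h.integral_sq_sub_le (sq_nonneg c)

lemma map_iff {φ : Ω' → Ω} {ν : Measure Ω'} (hφ : AEMeasurable φ ν)
    (hX : AEStronglyMeasurable X (ν.map φ)) :
    HasMeanVarLE (ν.map φ) X a V ↔ HasMeanVarLE ν (fun y => X (φ y)) a V := by
  have hvar : ∫ x, ‖X x - a‖ ^ 2 ∂(ν.map φ) = ∫ y, ‖X (φ y) - a‖ ^ 2 ∂ν :=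
    integral_map hφ ((hX.sub aestronglyMeasurable_const).norm.pow 2)
  constructor <;> rintro ⟨hL, hmean, hle⟩
  · exact ⟨(memLp_map_measure_iff hX hφ).1 hL, by rwa [integral_map hφ hX] at hmean,
      by rwa [← hvar]⟩
  · exact ⟨(memLp_map_measure_iff hX hφ).2 hL, by rwa [integral_map hφ hX], by rwa [hvar]⟩

lemma comp_measurePreserving {ν : Measure Ω'} {φ : Ω' → Ω} (h : HasMeanVarLE μ X a V)
    (hφ : MeasurePreserving φ ν μ) : HasMeanVarLE ν (fun y => X (φ y)) a V := by
  obtain ⟨hφ, rfl⟩ := hφ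
  exact (map_iff hφ.aemeasurable h.memLp.1).1 h

variable [IsFiniteMeasure μ]

lemma integrable (h : HasMeanVarLE μ X a V) : Integrable X μ := h.memLp.integrable one_le_two

lemma integrable_sub (h : HasMeanVarLE μ X a V) (c : E) : Integrable (fun x => X x - c) μ :=
  h.integrable.sub (integrable_const c)

lemma integrable_sq_sub (h : HasMeanVarLE μ X a V) (c : E) :
    Integrable (fun x => ‖X x - c‖ ^ 2) μ :=
  (h.memLp.sub (memLp_const c)).integrable_norm_pow two_ne_zero

lemma of_lintegral (hX : AEStronglyMeasurable X μ) (hV : 0 ≤ V)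
    (h : ∫⁻ x, ENNReal.ofReal (‖X x - a‖ ^ 2) ∂μ ≤ ENNReal.ofReal V)
    (hmean : Integrable X μ → ∫ x, X x ∂μ = a) : HasMeanVarLE μ X a V := by
  have hnonneg : 0 ≤ᵐ[μ] fun x => ‖X x - a‖ ^ 2 := ae_of_all _ fun x => sq_nonneg _
  have hXa : AEStronglyMeasurable (fun x => X x - a) μ := hX.sub aestronglyMeasurable_const
  have hint : Integrable (fun x => ‖X x - a‖ ^ 2) μ :=
    ⟨hXa.norm.pow 2, (hasFiniteIntegral_iff_ofReal hnonneg).2 (h.trans_lt ENNReal.ofReal_lt_top)⟩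
  have hL : MemLp X 2 μ := by
    simpa only [Pi.add_def, sub_add_cancel] using
      ((memLp_two_iff_integrable_sq_norm hXa).2 hint).add (memLp_const a)
  refine ⟨hL, hmean (hL.integrable one_le_two), ?_⟩
  rwa [← ENNReal.ofReal_le_ofReal_iff hV, ofReal_integral_eq_lintegral_ofReal hint hnonneg]

end NormedSpace

section InnerProductSpace

variable [InnerProductSpace ℝ E] [CompleteSpace E] {μ : Measure Ω} [IsProbabilityMeasure μ]
  {X Y : Ω → E} {a b : E} {U V : ℝ}

lemma integral_sub_mean (h : HasMeanVarLE μ X a V) : ∫ x, (X x - a) ∂μ = 0 := by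
  rw [integral_sub h.integrable (integrable_const a), h.integral_eq, integral_const, probReal_univ,
    one_smul, sub_self]

lemma integral_sq_sub_eq (h : HasMeanVarLE μ X a V) (c : E) :
    ∫ x, ‖X x - c‖ ^ 2 ∂μ = ∫ x, ‖X x - a‖ ^ 2 ∂μ + ‖a - c‖ ^ 2 := by
  have hcross : ∫ x, ⟪X x - a, a - c⟫ ∂μ = 0 := by
    simp_rw [real_inner_comm (a - c)]
    rw [integral_inner (h.integrable_sub a), h.integral_sub_mean, inner_zero_right]
  rw [integral_congr_ae (ae_of_all _ fun x => by rw [← sub_add_sub_cancel (X x) a c]),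
    integral_norm_add_sq (h.integrable_sq_sub a) ((h.integrable_sub a).inner_const (a - c))
    (integrable_const _), hcross, mul_zero, add_zero, integral_const, probReal_univ, one_smul]

lemma integral_sq_sub_const_le (h : HasMeanVarLE μ X a V) (c : E) :
    ∫ x, ‖X x - c‖ ^ 2 ∂μ ≤ V + ‖a - c‖ ^ 2 := by
  rw [h.integral_sq_sub_eq c]
  exact add_le_add_left h.integral_sq_sub_le _

lemma integral_sq_le (h : HasMeanVarLE μ X a V) : ∫ x, ‖X x‖ ^ 2 ∂μ ≤ V + ‖a‖ ^ 2 := by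
  simpa only [sub_zero] using h.integral_sq_sub_const_le 0

lemma lintegral_sq_sub_const_le (h : HasMeanVarLE μ X a V) (c : E) :
    ∫⁻ x, ENNReal.ofReal (‖X x - c‖ ^ 2) ∂μ ≤ ENNReal.ofReal (V + ‖a - c‖ ^ 2) := by
  rw [← ofReal_integral_eq_lintegral_ofReal (h.integrable_sq_sub c)
    (ae_of_all _ fun x => sq_nonneg _)]
  exact ENNReal.ofReal_le_ofReal (h.integral_sq_sub_const_le c)

lemma compProd (h : HasMeanVarLE μ X a V) {κ : Kernel Ω Ω'} [IsMarkovKernel κ]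
    {Y : Ω × Ω' → E} (hY : StronglyMeasurable Y) {W : Ω → ℝ} (hW : Integrable W μ)
    (hWU : ∫ x, W x ∂μ ≤ U) (hκ : ∀ x, HasMeanVarLE (κ x) (fun y => Y (x, y)) (X x) (W x)) :
    HasMeanVarLE (μ ⊗ₘ κ) Y a (V + U) := by
  have hW0 : ∀ x, 0 ≤ W x := fun x => (hκ x).nonneg
  refine of_lintegral hY.aestronglyMeasurable
    (add_nonneg h.nonneg ((integral_nonneg hW0).trans hWU)) ?_ fun hint => ?_
  · have hmeas : Measurable fun p => ENNReal.ofReal (‖Y p - a‖ ^ 2) :=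
      ((hY.sub stronglyMeasurable_const).norm.measurable.pow_const 2).ennreal_ofReal
    rw [Measure.lintegral_compProd hmeas]
    calc ∫⁻ x, ∫⁻ y, ENNReal.ofReal (‖Y (x, y) - a‖ ^ 2) ∂κ x ∂μ
        ≤ ∫⁻ x, ENNReal.ofReal (W x + ‖X x - a‖ ^ 2) ∂μ :=
          lintegral_mono fun x => (hκ x).lintegral_sq_sub_const_le a
      _ = ENNReal.ofReal (∫ x, W x + ‖X x - a‖ ^ 2 ∂μ) :=
          (ofReal_integral_eq_lintegral_ofReal (hW.add (h.integrable_sq_sub a))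
            (ae_of_all _ fun x => add_nonneg (hW0 x) (sq_nonneg _))).symm
      _ ≤ ENNReal.ofReal (V + U) := by
          rw [integral_add hW (h.integrable_sq_sub a), add_comm V]
          exact ENNReal.ofReal_le_ofReal (add_le_add hWU h.integral_sq_sub_le)
  · rw [Measure.integral_compProd hint, ← h.integral_eq]
    exact integral_congr_ae (ae_of_all _ fun x => (hκ x).integral_eq)

variable [MeasurableSpace E] [BorelSpace E]

lemma bind [SecondCountableTopology E] (h : HasMeanVarLE μ X a V) {κ : Kernel Ω E}
    [IsMarkovKernel κ] {W : Ω → ℝ} (hW : Integrable W μ) (hWU : ∫ x, W x ∂μ ≤ U)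
    (hκ : ∀ x, HasMeanVarLE (κ x) (fun y => y) (X x) (W x)) :
    HasMeanVarLE (κ ∘ₘ μ) (fun y => y) a (V + U) := by
  rw [← Measure.snd_compProd, Measure.snd,
    map_iff measurable_snd.aemeasurable measurable_id'.aestronglyMeasurable]
  exact h.compProd measurable_snd.stronglyMeasurable hW hWU hκ

lemma add (hX : HasMeanVarLE μ X a V) (hY : HasMeanVarLE μ Y b U) (hXY : IndepFun X Y μ) :
    HasMeanVarLE μ (X + Y) (a + b) (V + U) := by
  refine ⟨hX.memLp.add hY.memLp, ?_, ?_⟩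
  · rw [integral_add' hX.integrable hY.integrable, hX.integral_eq, hY.integral_eq]
  have hindep : IndepFun (fun x => X x - a) (fun x => Y x - b) μ :=
    hXY.comp (measurable_id.sub_const a) (measurable_id.sub_const b)
  have hcross : ∫ x, ⟪X x - a, Y x - b⟫ ∂μ = 0 :=
    (hindep.integral_bilin (hX.integrable_sub a) (hY.integrable_sub b) (innerSL ℝ)).trans (by
      rw [hX.integral_sub_mean, map_zero, zero_apply])
  simp_rw [Pi.add_apply, add_sub_add_comm]
  rw [integral_norm_add_sq (hX.integrable_sq_sub a)
    (hindep.integrable_bilin (hX.integrable_sub a) (hY.integrable_sub b) (innerSL ℝ))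
    (hY.integrable_sq_sub b), hcross, mul_zero, add_zero]
  exact add_le_add hX.integral_sq_sub_le hY.integral_sq_sub_le

lemma sum [SecondCountableTopology E] {ι : Type*} {X : ι → Ω → E} {a : ι → E} {V : ι → ℝ}
    (h : ∀ i, HasMeanVarLE μ (X i) (a i) (V i)) (hX : iIndepFun X μ) (s : Finset ι) :
    HasMeanVarLE μ (∑ i ∈ s, X i) (∑ i ∈ s, a i) (∑ i ∈ s, V i) := by
  classical
  induction s using Finset.induction_on with
  | empty => exact ⟨by simp, by simp, by simp⟩
  | insert i s hi ih =>
    rw [Finset.sum_insert hi, Finset.sum_insert hi, Finset.sum_insert hi]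
    exact (h i).add ih (hX.indepFun_finsetSum_of_notMem₀
      (fun j => (h j).memLp.1.aemeasurable) hi).symm

lemma pi_sum [SecondCountableTopology E] {ι : Type*} [Fintype ι] {Ω : ι → Type*}
    [∀ i, MeasurableSpace (Ω i)] {μ : ∀ i, Measure (Ω i)} [∀ i, IsProbabilityMeasure (μ i)]
    {X : ∀ i, Ω i → E} {a : ι → E} {V : ι → ℝ} (h : ∀ i, HasMeanVarLE (μ i) (X i) (a i) (V i)) :
    HasMeanVarLE (Measure.pi μ) (fun y => ∑ i, X i (y i)) (∑ i, a i) (∑ i, V i) := by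
  simpa only [Finset.sum_fn] using sum
    (fun i => (h i).comp_measurePreserving (measurePreserving_eval μ i))
    (iIndepFun_pi fun i => (h i).memLp.1.aemeasurable) Finset.univ

end InnerProductSpace

end HasMeanVarLE

/-! ### Smooth functions -/

section Smooth

variable {d k : ℕ} {L G : ℝ}

lemma norm_average_le {E : Type*} [SeminormedAddCommGroup E] [NormedSpace ℝ E] (hk : 1 ≤ k)
    {g : Fin k → E} (hg : ∀ j, ‖g j‖ ≤ G) : ‖(1 / (k : ℝ)) • ∑ j, g j‖ ≤ G := by
  have hk0 : (0 : ℝ) < k := by exact_mod_cast hk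
  rw [norm_smul, Real.norm_of_nonneg (by positivity), one_div, inv_mul_le_iff₀ hk0]
  simpa only [Finset.sum_const, Finset.card_univ, Fintype.card_fin, nsmul_eq_mul] using
    norm_sum_le_of_le Finset.univ fun j _ => hg j

lemma hasGradientAt_average {g : Fin k → Vec d → ℝ} {g' : Fin k → Vec d} {x : Vec d}
    (h : ∀ j, HasGradientAt (g j) (g' j) x) :
    HasGradientAt (fun y => (1 / (k : ℝ)) * ∑ j, g j y) ((1 / (k : ℝ)) • ∑ j, g' j) x := by
  rw [hasGradientAt_iff_hasFDerivAt, map_smul, map_sum]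
  exact (HasFDerivAt.fun_sum fun j _ => (h j).hasFDerivAt).const_mul _

lemma differentiable_average {g : Fin k → Vec d → ℝ} (hg : ∀ j, Differentiable ℝ (g j)) :
    Differentiable ℝ fun y => (1 / (k : ℝ)) * ∑ j, g j y := fun x =>
  (hasGradientAt_average fun j => (hg j x).hasGradientAt).differentiableAt

lemma gradient_average {g : Fin k → Vec d → ℝ} (hg : ∀ j, Differentiable ℝ (g j)) (x : Vec d) :
    gradient (fun y => (1 / (k : ℝ)) * ∑ j, g j y) x
      = (1 / (k : ℝ)) • ∑ j, gradient (g j) x :=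
  (hasGradientAt_average fun j => (hg j x).hasGradientAt).gradient

lemma HasBoundedGradient.average (hk : 1 ≤ k) {g : Fin k → Vec d → ℝ}
    (hg : ∀ j, Differentiable ℝ (g j)) (hG : ∀ j, HasBoundedGradient G (g j)) :
    HasBoundedGradient G fun y => (1 / (k : ℝ)) * ∑ j, g j y := fun x => by
  rw [gradient_average hg]
  exact norm_average_le hk fun j => hG j x

namespace IsSmooth

lemma average (hk : 1 ≤ k) {g : Fin k → Vec d → ℝ} (hg : ∀ j, IsSmooth L (g j)) :
    IsSmooth L fun y => (1 / (k : ℝ)) * ∑ j, g j y := by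
  refine ⟨differentiable_average fun j => (hg j).1, fun x y => ?_⟩
  rw [gradient_average fun j => (hg j).1, gradient_average fun j => (hg j).1, ← smul_sub,
    ← Finset.sum_sub_distrib]
  exact norm_average_le hk fun j => (hg j).2 x y

variable {F : Vec d → ℝ}

lemma inner_gradient_sub_le (hF : IsSmooth L F) (x w : Vec d) {t : ℝ} (ht : 0 ≤ t) :
    ⟪gradient F (x + t • w) - gradient F x, w⟫ ≤ L * t * ‖w‖ ^ 2 :=
  calc ⟪gradient F (x + t • w) - gradient F x, w⟫
      ≤ ‖gradient F (x + t • w) - gradient F x‖ * ‖w‖ := real_inner_le_norm _ _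
    _ ≤ L * ‖x + t • w - x‖ * ‖w‖ := by
        gcongr
        exact hF.2 _ _
    _ = L * t * ‖w‖ ^ 2 := by
        rw [add_sub_cancel_left, norm_smul, Real.norm_of_nonneg ht]
        ring

-- `F (x + t • w)` minus its quadratic upper model is antitone in `t` on `[0, 1]`.
lemma le_quadratic (hF : IsSmooth L F) (x w : Vec d) :
    F (x + w) ≤ F x + ⟪gradient F x, w⟫ + L / 2 * ‖w‖ ^ 2 := by
  let gap : ℝ → ℝ := fun t => F (x + t • w) - (t * ⟪gradient F x, w⟫ + L / 2 * ‖w‖ ^ 2 * t ^ 2)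
  have hgap : ∀ t, HasDerivAt gap (⟪gradient F (x + t • w), w⟫
      - (⟪gradient F x, w⟫ + L / 2 * ‖w‖ ^ 2 * (2 * t))) t := fun t => by
    have hline : HasDerivAt (fun t : ℝ => x + t • w) w t := by
      simpa only [one_smul] using ((hasDerivAt_id' t).smul_const w).const_add x
    have hF' := (hF.1 (x + t • w)).hasFDerivAt.comp_hasDerivAt t hline
    rw [← inner_gradient_left] at hF'
    have hmodel : HasDerivAt (fun t => t * ⟪gradient F x, w⟫ + L / 2 * ‖w‖ ^ 2 * t ^ 2)
        (⟪gradient F x, w⟫ + L / 2 * ‖w‖ ^ 2 * (2 * t)) t := by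
      simpa using ((hasDerivAt_id' t).mul_const ⟪gradient F x, w⟫).fun_add
        ((hasDerivAt_pow 2 t).const_mul (L / 2 * ‖w‖ ^ 2))
    exact hF'.sub hmodel
  have hanti : AntitoneOn gap (Set.Icc 0 1) :=
    antitoneOn_of_deriv_nonpos (convex_Icc 0 1)
      (fun t _ => (hgap t).continuousAt.continuousWithinAt)
      (fun t _ => (hgap t).differentiableAt.differentiableWithinAt) fun t ht => by
        rw [interior_Icc] at ht
        rw [(hgap t).deriv]
        have hinner := hF.inner_gradient_sub_le x w ht.1.le
        rw [inner_sub_left] at hinner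
        linarith
  have hle : gap 1 ≤ gap 0 :=
    hanti (Set.left_mem_Icc.2 zero_le_one) (Set.right_mem_Icc.2 zero_le_one) zero_le_one
  simp only [gap, one_smul, zero_smul, add_zero, one_mul, zero_mul, one_pow, mul_one] at hle
  linarith

lemma gradient_eq_zero (hF : IsSmooth 0 F) (hbdd : BddBelow (Set.range F)) (x : Vec d) :
    gradient F x = 0 := by
  obtain ⟨B, hB⟩ := hbdd
  by_contra hne
  have hpos : 0 < ‖gradient F x‖ ^ 2 := by positivity
  let s : ℝ := (F x - B + 1) / ‖gradient F x‖ ^ 2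
  have hs : s * ‖gradient F x‖ ^ 2 = F x - B + 1 := div_mul_cancel₀ _ hpos.ne'
  have hlower : B ≤ F (x + -s • gradient F x) := hB ⟨_, rfl⟩
  have hupper := hF.le_quadratic x (-s • gradient F x)
  rw [inner_smul_right, real_inner_self_eq_norm_sq, zero_div, zero_mul, neg_mul, hs] at hupper
  linarith

lemma step_le_quadratic (hF : IsSmooth L F) (η : ℝ) (x v : Vec d) :
    F (x - η • v) ≤ F x - η * ⟪gradient F x, v⟫ + L * η ^ 2 / 2 * ‖v‖ ^ 2 := by
  have hle := hF.le_quadratic x (-(η • v))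
  rw [inner_neg_right, inner_smul_right, norm_neg, norm_smul, mul_pow, Real.norm_eq_abs, sq_abs,
    ← sub_eq_add_neg] at hle
  linarith

variable {Ω : Type*} [MeasurableSpace Ω] {μ : Measure Ω} [IsProbabilityMeasure μ] {B η V : ℝ}
  {x a : Vec d} {v : Ω → Vec d}

lemma integrable_quadratic_step (hv : HasMeanVarLE μ v a V) (F : Vec d → ℝ) (L η : ℝ) (x : Vec d) :
    Integrable (fun h => F x - η * ⟪gradient F x, v h⟫ + L * η ^ 2 / 2 * ‖v h‖ ^ 2) μ :=
  ((integrable_const _).sub ((hv.integrable.const_inner _).const_mul η)).add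
    (by simpa only [sub_zero] using (hv.integrable_sq_sub 0).const_mul (L * η ^ 2 / 2))

lemma integrable_step (hF : IsSmooth L F) (hB : ∀ y, B ≤ F y) (hv : HasMeanVarLE μ v a V) (η : ℝ)
    (x : Vec d) : Integrable (fun h => F (x - η • v h)) μ :=
  integrable_of_le_of_le
    (hF.1.continuous.comp_aestronglyMeasurable (aestronglyMeasurable_const.sub
      (hv.memLp.1.const_smul η)))
    (ae_of_all _ fun _ => hB _) (ae_of_all _ fun h => hF.step_le_quadratic η x (v h))
    (integrable_const B) (integrable_quadratic_step hv F L η x)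

lemma integral_step_le (hF : IsSmooth L F) (hB : ∀ y, B ≤ F y) (hL : 0 ≤ L) (hη : 0 ≤ η)
    (hηL : η * L ≤ 1) (hv : HasMeanVarLE μ v (gradient F x) V) :
    ∫ h, F (x - η • v h) ∂μ ≤ F x - η / 2 * ‖gradient F x‖ ^ 2 + L * η ^ 2 / 2 * V := by
  have hsq : Integrable (fun h => ‖v h‖ ^ 2) μ := hv.memLp.integrable_norm_pow two_ne_zero
  have hinner : Integrable (fun h => η * ⟪gradient F x, v h⟫) μ :=
    (hv.integrable.const_inner _).const_mul η
  have hlin : Integrable (fun h => F x - η * ⟪gradient F x, v h⟫) μ :=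
    (integrable_const _).sub hinner
  calc ∫ h, F (x - η • v h) ∂μ
      ≤ ∫ h, F x - η * ⟪gradient F x, v h⟫ + L * η ^ 2 / 2 * ‖v h‖ ^ 2 ∂μ :=
        integral_mono (hF.integrable_step hB hv η x) (integrable_quadratic_step hv F L η x)
          fun h => hF.step_le_quadratic η x (v h)
    _ = F x - η * ‖gradient F x‖ ^ 2 + L * η ^ 2 / 2 * ∫ h, ‖v h‖ ^ 2 ∂μ := by
        rw [integral_add hlin (hsq.const_mul _),
          integral_sub (integrable_const _) hinner, integral_const_mul, integral_const_mul,
          integral_inner hv.integrable, hv.integral_eq, real_inner_self_eq_norm_sq, integral_const,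
          probReal_univ, one_smul]
    _ ≤ F x - η * ‖gradient F x‖ ^ 2 + L * η ^ 2 / 2 * (V + ‖gradient F x‖ ^ 2) := by
        gcongr
        exact hv.integral_sq_le
    _ ≤ F x - η / 2 * ‖gradient F x‖ ^ 2 + L * η ^ 2 / 2 * V := by
        have hquad : η * L * η * ‖gradient F x‖ ^ 2 ≤ 1 * η * ‖gradient F x‖ ^ 2 := by gcongr
        linarith

lemma lintegral_step_add_le (hF : IsSmooth L F) (hB : ∀ y, B ≤ F y) (hL : 0 ≤ L) (hη : 0 ≤ η)
    (hηL : η * L ≤ 1) (hv : HasMeanVarLE μ v (gradient F x) V) :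
    ∫⁻ h, ENNReal.ofReal (F (x - η • v h) - B) ∂μ + ENNReal.ofReal (η / 2 * ‖gradient F x‖ ^ 2)
      ≤ ENNReal.ofReal (F x - B) + ENNReal.ofReal (L * η ^ 2 / 2 * V) := by
  have hV := hv.nonneg
  have hint := hF.integrable_step hB hv η x
  have hgap : Integrable (fun h => F (x - η • v h) - B) μ := hint.sub (integrable_const B)
  rw [← ofReal_integral_eq_lintegral_ofReal hgap
      (ae_of_all _ fun h => sub_nonneg.2 (hB _)),
    ← ENNReal.ofReal_add (integral_nonneg fun h => sub_nonneg.2 (hB _)) (by positivity),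
    ← ENNReal.ofReal_add (sub_nonneg.2 (hB x)) (by positivity),
    integral_sub hint (integrable_const B), integral_const, probReal_univ, one_smul]
  exact ENNReal.ofReal_le_ofReal (by linarith [hF.integral_step_le hB hL hη hηL hv])

end IsSmooth

end Smooth

/-! ### Moments of the messages -/

lemma HasMeanVarLE.smul_const {Ω E : Type*} [MeasurableSpace Ω] [NormedAddCommGroup E]
    [NormedSpace ℝ E] [CompleteSpace E] {μ : Measure Ω} {X : Ω → ℝ} {a V : ℝ}
    (h : HasMeanVarLE μ X a V) (w : E) :
    HasMeanVarLE μ (fun x => X x • w) (a • w) (V * ‖w‖ ^ 2) := by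
  refine ⟨(ContinuousLinearMap.toSpanSingleton ℝ w).comp_memLp' h.memLp,
    by rw [integral_smul_const, h.integral_eq], ?_⟩
  simp_rw [← sub_smul, norm_smul, mul_pow, integral_mul_const]
  exact mul_le_mul_of_nonneg_right h.integral_sq_sub_le (sq_nonneg _)

lemma hasMeanVarLE_gaussianReal (a : ℝ) (v : NNReal) :
    HasMeanVarLE (gaussianReal a v) (fun x => x) a v := by
  refine ⟨memLp_id_gaussianReal 2, integral_id_gaussianReal, le_of_eq ?_⟩
  rw [← variance_id_gaussianReal (μ := a) (v := v), variance_eq_integral aemeasurable_id]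
  simp only [Real.norm_eq_abs, sq_abs, id_eq, integral_id_gaussianReal]

lemma hasMeanVarLE_stdGaussian (E : Type*) [NormedAddCommGroup E] [InnerProductSpace ℝ E]
    [FiniteDimensional ℝ E] [MeasurableSpace E] [BorelSpace E] :
    HasMeanVarLE (stdGaussian E) (fun z => z) 0 (Module.finrank ℝ E) := by
  rw [stdGaussian, HasMeanVarLE.map_iff (Measurable.aemeasurable (by fun_prop)) (by fun_prop)]
  have h := HasMeanVarLE.pi_sum fun i => (hasMeanVarLE_gaussianReal 0 1).smul_const
    (stdOrthonormalBasis ℝ E i)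
  simpa only [zero_smul, Finset.sum_const_zero, NNReal.coe_one, OrthonormalBasis.norm_eq_one,
    one_pow, mul_one, Finset.sum_const, Finset.card_univ, Fintype.card_fin, nsmul_eq_mul] using h

section Messages

variable {Z : Type*} {d n m b : ℕ} {ω G : ℝ} {f : Z → Vec d → ℝ}

lemma hasMeanVarLE_noiseLaw (d : ℕ) (σ : ℝ) :
    HasMeanVarLE (noiseLaw d σ) (fun ξ => ξ) 0 (d * σ ^ 2) := by
  rw [noiseLaw, HasMeanVarLE.map_iff (by fun_prop) (by fun_prop)]
  simpa only [smul_zero, finrank_euclideanSpace_fin, mul_comm (σ ^ 2)] using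
    (hasMeanVarLE_stdGaussian (Vec d)).const_smul σ

lemma hasMeanVarLE_bernoulliMeasure (q : unitInterval) :
    HasMeanVarLE (bernoulliMeasure true false q) (fun B => if B then (1 : ℝ) else 0) q q := by
  refine ⟨MemLp.of_bound (measurable_of_finite _).aestronglyMeasurable 1
    (ae_of_all _ fun B => by cases B <;> simp), by simp [integral_bernoulliMeasure], ?_⟩
  have hvar : ∫ B, ‖(if B then (1 : ℝ) else 0) - q‖ ^ 2 ∂bernoulliMeasure true false q
      = q - (q : ℝ) ^ 2 := by
    rw [integral_bernoulliMeasure]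
    simp only [↓reduceIte, Bool.false_eq_true, Real.norm_eq_abs, sq_abs, smul_eq_mul]
    ring
  rw [hvar]
  exact sub_le_self _ (sq_nonneg _)

lemma hasMeanVarLE_stochGrad (hf : ∀ z, Differentiable ℝ (f z))
    (hG : ∀ z, HasBoundedGradient G (f z)) (D : Fin m → Z) (hb : 1 ≤ b) (hbm : b ≤ m)
    (x : Vec d) :
    HasMeanVarLE (minibatchLaw b m) (stochGrad f D b x) (gradient (localLoss f D) x)
      (G ^ 2) := by
  have hb1 : (1 : ℝ) ≤ b := by exact_mod_cast hb
  have hm0 : (0 : ℝ) < m := by exact_mod_cast hb.trans hbm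
  have h := (HasMeanVarLE.pi_sum fun j : Fin m => (hasMeanVarLE_bernoulliMeasure
    (inclusionProb b m)).smul_const (gradient (f (D j)) x)).const_smul (1 / (b : ℝ))
  simp only [coe_inclusionProb hbm, ite_smul, one_smul, zero_smul] at h
  have hmean : (1 / (b : ℝ)) • ∑ j, ((b : ℝ) / m) • gradient (f (D j)) x
      = gradient (localLoss f D) x := by
    refine .trans ?_ (gradient_average (fun j => hf (D j)) x).symm
    rw [← Finset.smul_sum, smul_smul]
    congr 1
    field_simp
  rw [hmean] at h
  refine h.mono ?_
  calc (1 / (b : ℝ)) ^ 2 * ∑ j, (b : ℝ) / m * ‖gradient (f (D j)) x‖ ^ 2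
      ≤ (1 / (b : ℝ)) ^ 2 * ∑ _j : Fin m, (b : ℝ) / m * G ^ 2 := by
        gcongr with j
        exact hG _ _
    _ = G ^ 2 / b := by
        rw [Finset.sum_const, Finset.card_univ, Fintype.card_fin, nsmul_eq_mul]
        field_simp
    _ ≤ G ^ 2 := div_le_self (sq_nonneg G) hb1

lemma hasMeanVarLE_perturbedGradKernel (hf : ∀ z, Differentiable ℝ (f z))
    (hG : ∀ z, HasBoundedGradient G (f z)) (D : Fin m → Z) (hb : 1 ≤ b) (hbm : b ≤ m) (σ : ℝ)
    (x : Vec d) :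
    HasMeanVarLE (perturbedGradKernel f D b σ x) (fun y => y) (gradient (localLoss f D) x)
      (G ^ 2 + d * σ ^ 2) := by
  have hs : Measurable (stochGrad f D b x) := measurable_of_finite _
  rw [perturbedGradKernel_apply, HasMeanVarLE.map_iff (by fun_prop) (by fun_prop)]
  have h := ((hasMeanVarLE_stochGrad hf hG D hb hbm x).comp_measurePreserving
    measurePreserving_fst).add ((hasMeanVarLE_noiseLaw d σ).comp_measurePreserving
    measurePreserving_snd) (indepFun_prod hs measurable_id)
  rwa [add_zero] at h

lemma Compressor.hasMeanVarLE (C : Compressor d ω) (x : Vec d) :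
    HasMeanVarLE (C.kernel x) (fun y => y) x (ω * ‖x‖ ^ 2) := by
  refine ⟨?_, C.mean_eq x, C.variance_le x⟩
  simpa only [Pi.add_def, sub_add_cancel] using
    ((memLp_two_iff_integrable_sq_norm (by fun_prop)).2 (C.integrable_sq x)).add (memLp_const x)

lemma hasMeanVarLE_messageKernel (hf : ∀ z, Differentiable ℝ (f z))
    (hG : ∀ z, HasBoundedGradient G (f z)) (D : Fin m → Z) (hb : 1 ≤ b) (hbm : b ≤ m) (σ : ℝ)
    (hω : 0 ≤ ω) (C : Compressor d ω) (x : Vec d) :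
    HasMeanVarLE (messageKernel f D b σ C x) (fun y => y) (gradient (localLoss f D) x)
      ((1 + ω) * (2 * G ^ 2 + d * σ ^ 2)) := by
  have h := hasMeanVarLE_perturbedGradKernel hf hG D hb hbm σ x
  have hsq : Integrable (fun y : Vec d => ω * ‖y‖ ^ 2) (perturbedGradKernel f D b σ x) :=
    (h.memLp.integrable_norm_pow two_ne_zero).const_mul ω
  have hnorm : ‖gradient (localLoss f D) x‖ ≤ G :=
    HasBoundedGradient.average (hb.trans hbm) (fun j => hf (D j)) (fun j => hG (D j)) x
  have hle : ∫ y : Vec d, ω * ‖y‖ ^ 2 ∂(perturbedGradKernel f D b σ x)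
      ≤ ω * (G ^ 2 + d * σ ^ 2 + G ^ 2) := by
    rw [integral_const_mul]
    gcongr
    exact h.integral_sq_le.trans (by gcongr)
  rw [messageKernel, Kernel.comp_apply]
  exact (h.bind hsq hle C.hasMeanVarLE).mono (by linarith [sq_nonneg G])

lemma hasMeanVarLE_roundKernel (hf : ∀ z, Differentiable ℝ (f z))
    (hG : ∀ z, HasBoundedGradient G (f z)) (D : Fin n → Fin m → Z) (hb : 1 ≤ b) (hbm : b ≤ m)
    (σ : ℝ) (hω : 0 ≤ ω) (C : Fin n → Compressor d ω) (x : Vec d) :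
    HasMeanVarLE (roundKernel f D b σ C x) (fun h => (1 / (n : ℝ)) • ∑ i, h i)
      (gradient (globalLoss f D) x) ((1 + ω) * (2 * G ^ 2 + d * σ ^ 2) / n) := by
  rw [roundKernel_apply]
  have h := (HasMeanVarLE.pi_sum fun i =>
    hasMeanVarLE_messageKernel hf hG (D i) hb hbm σ hω (C i) x).const_smul (1 / (n : ℝ))
  have hmean : gradient (globalLoss f D) x
      = (1 / (n : ℝ)) • ∑ i, gradient (localLoss f (D i)) x :=
    gradient_average (fun i => differentiable_average fun j => hf (D i j)) x
  rw [hmean]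
  refine h.mono (le_of_eq ?_)
  rw [Finset.sum_const, Finset.card_univ, Fintype.card_fin, nsmul_eq_mul]
  field_simp

end Messages

/-! ### Utility -/

section Utility

lemma ofReal_integral_le_lintegral {Ω : Type*} [MeasurableSpace Ω] (μ : Measure Ω) (g : Ω → ℝ) :
    ENNReal.ofReal (∫ x, g x ∂μ) ≤ ∫⁻ x, ENNReal.ofReal (g x) ∂μ := by
  by_cases hg : Integrable g μ
  · rw [integral_eq_lintegral_pos_part_sub_lintegral_neg_part hg]
    exact ENNReal.ofReal_le_of_le_toReal (sub_le_self _ ENNReal.toReal_nonneg)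
  · rw [integral_undef hg, ENNReal.ofReal_zero]
    exact zero_le

lemma add_sum_range_le_add_nsmul {M : Type*} [AddCommMonoid M] [PartialOrder M]
    [IsOrderedAddMonoid M] {a g : ℕ → M} {c : M} (h : ∀ t, a (t + 1) + g t ≤ a t + c) (T : ℕ) :
    a T + ∑ t ∈ Finset.range T, g t ≤ a 0 + T • c := by
  induction T with
  | zero => simp
  | succ T ih =>
    calc a (T + 1) + ∑ t ∈ Finset.range (T + 1), g t
        = a (T + 1) + g T + ∑ t ∈ Finset.range T, g t := by
          rw [Finset.sum_range_succ, add_comm _ (g T), add_assoc]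
      _ ≤ a T + c + ∑ t ∈ Finset.range T, g t := by grw [h T]
      _ = a T + ∑ t ∈ Finset.range T, g t + c := add_right_comm _ _ _
      _ ≤ a 0 + T • c + c := by grw [ih]
      _ = a 0 + (T + 1) • c := by rw [add_assoc, succ_nsmul]

variable {Z : Type*} {d n m b : ℕ} {ω L G η σ V B Δ : ℝ}

lemma isSmooth_globalLoss {f : Z → Vec d → ℝ} (hf : ∀ z, IsSmooth L (f z))
    (D : Fin n → Fin m → Z) (hn : 1 ≤ n) (hm : 1 ≤ m) : IsSmooth L (globalLoss f D) :=
  .average hn fun i => .average hm fun j => hf (D i j)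

lemma model_snoc (η : ℕ → ℝ) (x0 : Vec d) {t : ℕ} (h : Fin t → Fin n → Vec d)
    (v : Fin n → Vec d) :
    model η x0 (Fin.snoc (α := fun _ => Fin n → Vec d) h v : Fin (t + 1) → Fin n → Vec d)
      = model η x0 h - η t • ((1 / (n : ℝ)) • ∑ i, v i) := by
  simp only [model, Fin.sum_univ_castSucc, Fin.snoc_castSucc, Fin.snoc_last, Fin.val_castSucc,
    Fin.val_last]
  abel

lemma lintegral_transcriptLaw_succ (f : Z → Vec d → ℝ) (D : Fin n → Fin m → Z) (b : ℕ)
    (η : ℕ → ℝ) (σ : ℝ) (C : ℕ → Fin n → Compressor d ω) (x0 : Vec d) (t : ℕ)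
    {φ : Vec d → ℝ≥0∞} (hφ : Measurable φ) :
    ∫⁻ h, φ (model η x0 h) ∂(transcriptLaw f D b η σ C x0 (t + 1))
      = ∫⁻ h, ∫⁻ v, φ (model η x0 h - η t • ((1 / (n : ℝ)) • ∑ i, v i))
          ∂(roundKernel f D b σ (C t) (model η x0 h)) ∂(transcriptLaw f D b η σ C x0 t) := by
  have hmeas : Measurable fun h : Fin (t + 1) → Fin n → Vec d => φ (model η x0 h) :=
    hφ.comp (measurable_model η x0 (t + 1))
  rw [transcriptLaw, lintegral_map hmeas (measurable_snoc t),
    Measure.lintegral_compProd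
      (f := fun p => φ (model η x0 (Fin.snoc (α := fun _ => Fin n → Vec d) p.1 p.2)))
      (hmeas.comp (measurable_snoc t))]
  simp only [model_snoc, Kernel.comap_apply]

variable {F : Vec d → ℝ} {f : Z → Vec d → ℝ} {D : Fin n → Fin m → Z}
  {C : ℕ → Fin n → Compressor d ω}

lemma lintegral_transcriptLaw_succ_add_le (hF : IsSmooth L F) (hB : ∀ y, B ≤ F y) (hL : 0 ≤ L)
    (hη : 0 ≤ η) (hηL : η * L ≤ 1) (x0 : Vec d) {t : ℕ}
    (hround : ∀ x, HasMeanVarLE (roundKernel f D b σ (C t) x) (fun h => (1 / (n : ℝ)) • ∑ i, h i)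
      (gradient F x) V) :
    ∫⁻ h, ENNReal.ofReal (F (model (fun _ => η) x0 h) - B)
          ∂(transcriptLaw f D b (fun _ => η) σ C x0 (t + 1))
        + ∫⁻ h, ENNReal.ofReal (η / 2 * ‖gradient F (model (fun _ => η) x0 h)‖ ^ 2)
          ∂(transcriptLaw f D b (fun _ => η) σ C x0 t)
      ≤ ∫⁻ h, ENNReal.ofReal (F (model (fun _ => η) x0 h) - B)
          ∂(transcriptLaw f D b (fun _ => η) σ C x0 t)
        + ENNReal.ofReal (L * η ^ 2 / 2 * V) := by
  have hgrad : Measurable fun h : Fin t → Fin n → Vec d =>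
      ENNReal.ofReal (η / 2 * ‖gradient F (model (fun _ => η) x0 h)‖ ^ 2) :=
    ((((measurable_gradient F).comp (measurable_model _ x0 t)).norm.pow_const 2).const_mul
      _).ennreal_ofReal
  have hgap : Measurable fun x => ENNReal.ofReal (F x - B) :=
    (hF.1.continuous.measurable.sub_const B).ennreal_ofReal
  rw [lintegral_transcriptLaw_succ f D b (fun _ => η) σ C x0 t hgap,
    ← lintegral_add_right _ hgrad]
  refine (lintegral_mono fun h => hF.lintegral_step_add_le hB hL hη hηL (hround _)).trans_eq ?_
  rw [lintegral_add_right _ measurable_const, lintegral_const, measure_univ, mul_one]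

lemma sum_integral_sq_gradient_le (hF : IsSmooth L F) (hB : ∀ y, B ≤ F y) (hL : 0 ≤ L)
    (hη : 0 ≤ η) (hηL : η * L ≤ 1) (x0 : Vec d)
    (hround : ∀ t x, HasMeanVarLE (roundKernel f D b σ (C t) x)
      (fun h => (1 / (n : ℝ)) • ∑ i, h i) (gradient F x) V) (T : ℕ) :
    ∑ t ∈ Finset.range T, ∫ h, η / 2 * ‖gradient F (model (fun _ => η) x0 h)‖ ^ 2
        ∂(transcriptLaw f D b (fun _ => η) σ C x0 t)
      ≤ F x0 - B + T * (L * η ^ 2 / 2 * V) := by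
  have hV : 0 ≤ V := (hround 0 x0).nonneg
  have hgap : 0 ≤ F x0 - B := sub_nonneg.2 (hB x0)
  rw [← ENNReal.ofReal_le_ofReal_iff (by positivity), ENNReal.ofReal_sum_of_nonneg
    fun t _ => integral_nonneg fun h => by positivity]
  calc ∑ t ∈ Finset.range T, ENNReal.ofReal (∫ h, η / 2 *
          ‖gradient F (model (fun _ => η) x0 h)‖ ^ 2 ∂(transcriptLaw f D b (fun _ => η) σ C x0 t))
      ≤ ∑ t ∈ Finset.range T, ∫⁻ h, ENNReal.ofReal (η / 2 *
            ‖gradient F (model (fun _ => η) x0 h)‖ ^ 2)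
          ∂(transcriptLaw f D b (fun _ => η) σ C x0 t) :=
        Finset.sum_le_sum fun t _ => ofReal_integral_le_lintegral _ _
    _ ≤ _ := le_add_self.trans (add_sum_range_le_add_nsmul
        (fun t => lintegral_transcriptLaw_succ_add_le hF hB hL hη hηL x0 (hround t)) T)
    _ = ENNReal.ofReal (F x0 - B + T * (L * η ^ 2 / 2 * V)) := by
        rw [transcriptLaw, lintegral_dirac, model, Finset.univ_eq_empty, Finset.sum_empty, sub_zero,
          ← ENNReal.ofReal_nsmul, nsmul_eq_mul, ← ENNReal.ofReal_add hgap (by positivity)]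

lemma avgSqGradNorm_le (hf : ∀ z, IsSmooth L (f z)) (hG : ∀ z, HasBoundedGradient G (f z))
    (hn : 1 ≤ n) (hb : 1 ≤ b) (hbm : b ≤ m) (hω : 0 ≤ ω) (hL : 0 ≤ L) (hη : 0 < η)
    (hηL : η * L ≤ 1) (σ : ℝ) (C : ℕ → Fin n → Compressor d ω) (x0 : Vec d)
    (hbdd : BddBelow (Set.range (globalLoss f D)))
    (hΔ : globalLoss f D x0 - (⨅ x, globalLoss f D x) ≤ Δ) {T : ℕ} (hT : 1 ≤ T) :
    avgSqGradNorm f D b (fun _ => η) σ C x0 T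
      ≤ 2 * Δ / (η * T) + L * η * ((1 + ω) * (2 * G ^ 2 + d * σ ^ 2) / n) := by
  have hF := isSmooth_globalLoss hf D hn (hb.trans hbm)
  have hsum := sum_integral_sq_gradient_le hF (ciInf_le hbdd) hL hη.le hηL x0 (fun t =>
    hasMeanVarLE_roundKernel (fun z => (hf z).1) hG D hb hbm σ hω (C t)) T
  simp only [integral_const_mul, ← Finset.mul_sum] at hsum
  rw [avgSqGradNorm]
  calc 1 / (T : ℝ) * ∑ t ∈ Finset.range T, ∫ h, ‖gradient (globalLoss f D)
          (model (fun _ => η) x0 h)‖ ^ 2 ∂(transcriptLaw f D b (fun _ => η) σ C x0 t)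
      = 2 / (η * T) * (η / 2 * ∑ t ∈ Finset.range T, ∫ h, ‖gradient (globalLoss f D)
          (model (fun _ => η) x0 h)‖ ^ 2 ∂(transcriptLaw f D b (fun _ => η) σ C x0 t)) := by
        field_simp
    _ ≤ 2 / (η * T) * (Δ + T * (L * η ^ 2 / 2 * ((1 + ω) * (2 * G ^ 2 + d * σ ^ 2) / n))) := by
        gcongr
        exact hsum.trans (by gcongr)
    _ = 2 * Δ / (η * T) + L * η * ((1 + ω) * (2 * G ^ 2 + d * σ ^ 2) / n) := by field_simp

lemma avgSqGradNorm_eq_zero (hf : ∀ z, IsSmooth 0 (f z)) (hn : 1 ≤ n) (hm : 1 ≤ m) (b : ℕ)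
    (η : ℕ → ℝ) (σ : ℝ) (C : ℕ → Fin n → Compressor d ω) (x0 : Vec d)
    (hbdd : BddBelow (Set.range (globalLoss f D))) (T : ℕ) :
    avgSqGradNorm f D b η σ C x0 T = 0 := by
  simp only [avgSqGradNorm, (isSmooth_globalLoss hf D hn hm).gradient_eq_zero hbdd, norm_zero,
    ne_eq, OfNat.ofNat_ne_zero, not_false_eq_true, zero_pow, integral_zero, Finset.sum_const_zero,
    mul_zero]

end Utility

/-! ### The choice of the parameters -/

section Parameters

variable {n m d b T : ℕ} {K L G ω ε δ Δ : ℝ}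

/-- The scale `ρ` of the privacy noise in a message: over `T` rounds the noise has to contribute
`(1 + ω) d σ² ≈ T ρ²` to the variance of each message. -/
noncomputable def privacyScale (m d : ℕ) (G ω ε δ : ℝ) : ℝ :=
  G * √((1 + ω) * d * Real.log (1 / δ)) / (m * ε)

/-- The standard deviation of the privacy noise of a single coordinate. -/
noncomputable def noiseLevel (K : ℝ) (m T : ℕ) (G ε δ : ℝ) : ℝ :=
  √(160 * (2 + K) * G ^ 2 * T * Real.log (1 / δ) / (m ^ 2 * ε ^ 2))

/-- The stepsize, which balances the two terms of the bound `avgSqGradNorm_le`. For `L = 0` an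
objective that is bounded below is constant, and every stepsize will do. -/
noncomputable def stepsize (n m d T : ℕ) (L G ω ε δ Δ : ℝ) : ℝ :=
  if L = 0 then 1 else n * Δ / (privacyScale m d G ω ε δ * √(n * L * Δ) * T)

lemma privacyScale_pos (hm : 1 ≤ m) (hd : 1 ≤ d) (hG : 0 < G) (hω : 0 ≤ ω) (hε : 0 < ε)
    (hl : 0 < Real.log (1 / δ)) : 0 < privacyScale m d G ω ε δ := by
  unfold privacyScale
  positivity

lemma roundOrder_eq (n m d : ℕ) (L G ω ε δ Δ : ℝ) :
    roundOrder n m d L G ω ε δ Δ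
      = √(n * L * Δ) / privacyScale m d G ω ε δ + m ^ 2 * ε ^ 2 / (d * Real.log (1 / δ)) := by
  rw [roundOrder, privacyScale, div_div_eq_mul_div, mul_assoc √(n * L * Δ)]

lemma utilityOrder_eq (hL : 0 ≤ L) (hΔ : 0 ≤ Δ) (n m d : ℕ) (G ω ε δ : ℝ) :
    utilityOrder n m d L G ω ε δ Δ = privacyScale m d G ω ε δ * √(n * L * Δ) / n := by
  have hradicand : (1 + ω) * L * Δ * d * Real.log (1 / δ)
      = (1 + ω) * d * Real.log (1 / δ) * (L * Δ) := by ring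
  rw [utilityOrder, privacyScale, hradicand, Real.sqrt_mul' _ (mul_nonneg hL hΔ),
    mul_assoc (n : ℝ) L Δ, Real.sqrt_mul n.cast_nonneg]
  calc G * (√((1 + ω) * d * Real.log (1 / δ)) * √(L * Δ)) / (√n * m * ε)
      = G * √((1 + ω) * d * Real.log (1 / δ)) / (m * ε) * √(L * Δ) * (1 / √n) := by ring
    _ = G * √((1 + ω) * d * Real.log (1 / δ)) / (m * ε) * √(L * Δ) * (√n / n) := by
        rw [Real.sqrt_div_self']
    _ = G * √((1 + ω) * d * Real.log (1 / δ)) / (m * ε) * (√n * √(L * Δ)) / n := by ring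

lemma roundOrder_pos (hm : 1 ≤ m) (hd : 1 ≤ d) (hG : 0 < G) (hω : 0 ≤ ω) (hε : 0 < ε)
    (hl : 0 < Real.log (1 / δ)) (n : ℕ) (L Δ : ℝ) : 0 < roundOrder n m d L G ω ε δ Δ := by
  have hρ := privacyScale_pos hm hd hG hω hε hl
  rw [roundOrder_eq]
  positivity

lemma sq_noiseLevel (hK : 0 ≤ K) (hl : 0 ≤ Real.log (1 / δ)) (m T : ℕ) (G ε : ℝ) :
    noiseLevel K m T G ε δ ^ 2
      = 160 * (2 + K) * G ^ 2 * T * Real.log (1 / δ) / (m ^ 2 * ε ^ 2) :=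
  Real.sq_sqrt (by positivity)

lemma noiseLevel_pos (hK : 0 ≤ K) (hm : 1 ≤ m) (hT : 1 ≤ T) (hG : 0 < G) (hε : 0 < ε)
    (hl : 0 < Real.log (1 / δ)) : 0 < noiseLevel K m T G ε δ := by
  unfold noiseLevel
  positivity

lemma stepsize_pos (hn : 1 ≤ n) (hm : 1 ≤ m) (hd : 1 ≤ d) (hT : 1 ≤ T) (hL : 0 ≤ L) (hG : 0 < G)
    (hω : 0 ≤ ω) (hε : 0 < ε) (hΔ : 0 < Δ) (hl : 0 < Real.log (1 / δ)) :
    0 < stepsize n m d T L G ω ε δ Δ := by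
  have hρ := privacyScale_pos hm hd hG hω hε hl
  unfold stepsize
  split_ifs with h
  · exact one_pos
  · positivity

lemma exists_order (hε : 0 < ε) {l : ℝ} (hl : 0 < l) (hεK : ε ≤ K * l) :
    ∃ α : ℕ, 2 ≤ α ∧ 2 * l ≤ ε * (α - 1) ∧ ε * α ≤ 2 * (2 + K) * l := by
  have hpos : 0 < 2 * l / ε := by positivity
  have hceil : 1 ≤ ⌈2 * l / ε⌉₊ := Nat.one_le_ceil_iff.2 hpos
  have hle : 2 * l ≤ ε * ⌈2 * l / ε⌉₊ := (div_le_iff₀' hε).1 (Nat.le_ceil _)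
  have hlt : ε * ⌈2 * l / ε⌉₊ ≤ 2 * l + ε :=
    calc ε * ⌈2 * l / ε⌉₊ ≤ ε * (2 * l / ε + 1) := by
          gcongr
          exact (Nat.ceil_lt_add_one hpos.le).le
      _ = 2 * l + ε := by field_simp
  refine ⟨⌈2 * l / ε⌉₊ + 1, by lia, ?_, ?_⟩
  · rwa [Nat.cast_add_one, add_sub_cancel_right]
  · rw [Nat.cast_add_one]
    linarith

lemma sq_div_mul_noiseLevel (hK : 0 ≤ K) (hG : 0 < G) (hl : 0 ≤ Real.log (1 / δ)) (m T : ℕ)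
    (ε a : ℝ) :
    (G / (a * noiseLevel K m T G ε δ)) ^ 2
      = m ^ 2 * ε ^ 2 / (160 * (2 + K) * a ^ 2 * T * Real.log (1 / δ)) := by
  rw [div_pow, mul_pow, sq_noiseLevel hK hl]
  field_simp

lemma isLDP_noiseLevel (hK : 0 ≤ K) (hε : 0 < ε) (hδ : 0 < δ) (hl : 0 < Real.log (1 / δ))
    (hεK : ε ≤ K * Real.log (1 / δ)) (hT : 1 ≤ T) (hb : 1 ≤ b) (hbm : b ≤ m)
    (hbT : b = m ∨ ε ≤ ((b : ℝ) / m) ^ 2 * T) (hG0 : 0 < G) {Z : Type*} {f : Z → Vec d → ℝ}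
    (hG : ∀ z, HasBoundedGradient G (f z)) (η : ℕ → ℝ) (C : ℕ → Fin n → Compressor d ω)
    (x0 : Vec d) (D : Fin n → Fin m → Z) (i : Fin n) :
    IsLDP ε δ fun Di : Fin m → Z =>
      transcriptLaw f (Function.update D i Di) b η (noiseLevel K m T G ε δ) C x0 T := by
  have hm := hb.trans hbm
  have hσ := noiseLevel_pos hK hm hT hG0 hε hl
  have hsq := sq_div_mul_noiseLevel hK hG0 hl.le m T ε
  obtain ⟨α, hα, hαl, hαK⟩ := exists_order hε hl hεK
  have hα2 : (2 : ℝ) ≤ α := by exact_mod_cast hα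
  refine isLDP_transcriptLaw hG hb hbm hσ hα (hbT.imp_right fun hbT => ?_) hδ T ?_ η C x0 D i
  · have hbatch : m ^ 2 * ε ≤ b ^ 2 * T := by
      rwa [div_pow, div_mul_eq_mul_div, le_div_iff₀ (by positivity), mul_comm] at hbT
    rw [hsq, ← mul_div_assoc, div_le_one (by positivity)]
    calc 4 * α * ((m : ℝ) ^ 2 * ε ^ 2) = 4 * (m ^ 2 * ε * (ε * α)) := by ring
      _ ≤ 4 * (b ^ 2 * T * (2 * (2 + K) * Real.log (1 / δ))) := by gcongr
      _ = 8 * ((2 + K) * b ^ 2 * T * Real.log (1 / δ)) := by ring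
      _ ≤ 160 * ((2 + K) * b ^ 2 * T * Real.log (1 / δ)) := by gcongr; norm_num
      _ = 160 * (2 + K) * b ^ 2 * T * Real.log (1 / δ) := by ring
  · calc 20 * α ^ 2 * (G / (m * noiseLevel K m T G ε δ)) ^ 2 * T
        = ε * α * (ε * α) / (8 * (2 + K) * Real.log (1 / δ)) := by
          rw [hsq]
          field_simp
          norm_num
      _ ≤ ε * α * (2 * (2 + K) * Real.log (1 / δ)) / (8 * (2 + K) * Real.log (1 / δ)) := by gcongr
      _ = ε * α / 4 := by
          field_simp
          norm_num
      _ ≤ ε * (α - 1) - Real.log (1 / δ) := by nlinarith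

lemma one_add_mul_dim_mul_sq_noiseLevel (hK : 0 ≤ K) (hω : 0 ≤ ω) (hl : 0 ≤ Real.log (1 / δ))
    (m d T : ℕ) (G ε : ℝ) :
    (1 + ω) * (d * noiseLevel K m T G ε δ ^ 2)
      = 160 * (2 + K) * T * privacyScale m d G ω ε δ ^ 2 := by
  rw [sq_noiseLevel hK hl, privacyScale, div_pow, mul_pow G, Real.sq_sqrt (by positivity)]
  ring

lemma sq_le_dim_mul_sq_noiseLevel (hK : 0 ≤ K) (hm : 1 ≤ m) (hd : 1 ≤ d) (hε : 0 < ε)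
    (hl : 0 < Real.log (1 / δ)) (hT : m ^ 2 * ε ^ 2 / (d * Real.log (1 / δ)) ≤ T) :
    G ^ 2 ≤ d * noiseLevel K m T G ε δ ^ 2 := by
  rw [div_le_iff₀ (by positivity)] at hT
  rw [sq_noiseLevel hK hl.le, ← mul_div_assoc, le_div_iff₀ (by positivity)]
  calc G ^ 2 * (m ^ 2 * ε ^ 2) ≤ 1 * (G ^ 2 * (T * (d * Real.log (1 / δ)))) := by
        rw [one_mul]
        gcongr
    _ ≤ 160 * (2 + K) * (G ^ 2 * (T * (d * Real.log (1 / δ)))) := by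
        gcongr
        linarith
    _ = d * (160 * (2 + K) * G ^ 2 * T * Real.log (1 / δ)) := by ring

lemma stepsize_mul_le_one (hL : 0 ≤ L) (hΔ : 0 ≤ Δ)
    (hT : √(n * L * Δ) / privacyScale m d G ω ε δ ≤ T) :
    stepsize n m d T L G ω ε δ Δ * L ≤ 1 := by
  unfold stepsize
  split_ifs with h
  · rw [h, mul_zero]
    exact zero_le_one
  · have hr : n * Δ * L = √(n * L * Δ) * √(n * L * Δ) := by
      rw [Real.mul_self_sqrt (by positivity)]
      ring
    calc n * Δ / (privacyScale m d G ω ε δ * √(n * L * Δ) * T) * L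
        = √(n * L * Δ) / privacyScale m d G ω ε δ / T * (√(n * L * Δ) / √(n * L * Δ)) := by
          rw [div_mul_eq_mul_div, hr]
          ring
      _ ≤ 1 * 1 := by
          gcongr
          · exact div_le_one_of_le₀ hT T.cast_nonneg
          · exact div_self_le_one _
      _ = 1 := one_mul 1

lemma stepsize_bound_le_utilityOrder (hK : 0 ≤ K) (hn : 1 ≤ n) (hm : 1 ≤ m) (hd : 1 ≤ d)
    (hT : 1 ≤ T) (hL : 0 < L) (hG : 0 < G) (hω : 0 ≤ ω) (hε : 0 < ε) (hΔ : 0 < Δ)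
    (hl : 0 < Real.log (1 / δ)) (hTd : m ^ 2 * ε ^ 2 / (d * Real.log (1 / δ)) ≤ T) :
    2 * Δ / (stepsize n m d T L G ω ε δ Δ * T) + L * stepsize n m d T L G ω ε δ Δ
        * ((1 + ω) * (2 * G ^ 2 + d * noiseLevel K m T G ε δ ^ 2) / n)
      ≤ (2 + 480 * (2 + K)) * utilityOrder n m d L G ω ε δ Δ := by
  have hη := stepsize_pos hn hm hd hT hL.le hG hω hε hΔ hl
  have hvar : (1 + ω) * (2 * G ^ 2 + d * noiseLevel K m T G ε δ ^ 2)
      ≤ 480 * (2 + K) * T * privacyScale m d G ω ε δ ^ 2 := by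
    calc (1 + ω) * (2 * G ^ 2 + d * noiseLevel K m T G ε δ ^ 2)
        ≤ (1 + ω) * (2 * (d * noiseLevel K m T G ε δ ^ 2) + d * noiseLevel K m T G ε δ ^ 2) := by
          gcongr
          exact sq_le_dim_mul_sq_noiseLevel hK hm hd hε hl hTd
      _ = 480 * (2 + K) * T * privacyScale m d G ω ε δ ^ 2 := by
          linear_combination 3 * one_add_mul_dim_mul_sq_noiseLevel hK hω hl.le m d T G ε
  refine (add_le_add_right (mul_le_mul_of_nonneg_left (div_le_div_of_nonneg_right hvar
    n.cast_nonneg) (by positivity)) _).trans_eq ?_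
  have hρ := privacyScale_pos hm hd hG hω hε hl
  have hr : 0 < √(n * L * Δ) := by positivity
  have hr2 : √(n * L * Δ) ^ 2 = n * L * Δ := Real.sq_sqrt (by positivity)
  rw [utilityOrder_eq hL.le hΔ.le, stepsize, if_neg hL.ne']
  generalize √(n * L * Δ) = r at hr hr2 ⊢
  field_simp
  linear_combination (-(480 * (2 + K)) : ℝ) * hr2

lemma avgSqGradNorm_le_utilityOrder (hK : 0 ≤ K) (hε : 0 < ε) (hl : 0 < Real.log (1 / δ))
    (hn : 1 ≤ n) (hd : 1 ≤ d) (hL : 0 ≤ L) (hω : 0 ≤ ω) (hΔ : 0 < Δ) (hT : 1 ≤ T)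
    (hR : roundOrder n m d L G ω ε δ Δ ≤ T) (hb : 1 ≤ b) (hbm : b ≤ m) (hG0 : 0 < G) {Z : Type*}
    {f : Z → Vec d → ℝ} (hf : ∀ z, IsSmooth L (f z)) (hG : ∀ z, HasBoundedGradient G (f z))
    (C : ℕ → Fin n → Compressor d ω) (x0 : Vec d) {D : Fin n → Fin m → Z}
    (hbdd : BddBelow (Set.range (globalLoss f D)))
    (hgap : globalLoss f D x0 - (⨅ x, globalLoss f D x) ≤ Δ) :
    avgSqGradNorm f D b (fun _ => stepsize n m d T L G ω ε δ Δ) (noiseLevel K m T G ε δ) C x0 T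
      ≤ (2 + 480 * (2 + K)) * utilityOrder n m d L G ω ε δ Δ := by
  have hm := hb.trans hbm
  have hρ := privacyScale_pos hm hd hG0 hω hε hl
  rw [roundOrder_eq] at hR
  rcases hL.eq_or_lt with rfl | hL0
  · rw [avgSqGradNorm_eq_zero hf hn hm b _ _ C x0 hbdd, utilityOrder_eq le_rfl hΔ.le]
    positivity
  · exact (avgSqGradNorm_le hf hG hn hb hbm hω hL (stepsize_pos hn hm hd hT hL hG0 hω hε hΔ hl)
      (stepsize_mul_le_one hL hΔ.le ((le_add_of_nonneg_right (by positivity)).trans hR)) _ C x0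
      hbdd hgap hT).trans (stepsize_bound_le_utilityOrder hK hn hm hd hT hL0 hG0 hω hε hΔ hl
      ((le_add_of_nonneg_left (by positivity)).trans hR))

end Parameters

end CDPSGD

theorem mainTheorem3 (K : ℝ) (hK : 0 < K) :
    ∃ A : ℝ, 0 < A ∧ ∃ c : ℝ, 0 < c ∧
      ∀ (n m d : ℕ) (L G ω ε δ Δ : ℝ),
        1 ≤ n → 1 ≤ m → 1 ≤ d → 0 ≤ L → 0 < G → 0 ≤ ω → 0 < Δ →
        0 < ε → 0 < δ → δ < 1 → ε ≤ K * Real.log (1 / δ) →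
        ∃ (T : ℕ) (η σ : ℝ),
          1 ≤ T ∧
          CDPSGD.roundOrder n m d L G ω ε δ Δ / A ≤ T ∧
          T ≤ 1 + A * CDPSGD.roundOrder n m d L G ω ε δ Δ ∧
          0 < η ∧ 0 < σ ∧
          ∀ b : ℕ, 1 ≤ b → b ≤ m → (b = m ∨ ε ≤ c * ((b : ℝ) / m) ^ 2 * T) →
            ∀ (Z : Type*) (f : Z → CDPSGD.Vec d → ℝ),
              (∀ z, CDPSGD.IsSmooth L (f z)) →
              (∀ z, CDPSGD.HasBoundedGradient G (f z)) →
              ∀ (C : ℕ → Fin n → CDPSGD.Compressor d ω) (x0 : CDPSGD.Vec d)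
                (D : Fin n → Fin m → Z),
                (∀ i : Fin n, CDPSGD.IsLDP ε δ fun Di : Fin m → Z =>
                  CDPSGD.transcriptLaw f (Function.update D i Di) b (fun _ => η) σ C x0 T) ∧
                (BddBelow (Set.range (CDPSGD.globalLoss f D)) →
                  CDPSGD.globalLoss f D x0 - (⨅ x, CDPSGD.globalLoss f D x) ≤ Δ →
                  CDPSGD.avgSqGradNorm f D b (fun _ => η) σ C x0 T
                    ≤ A * CDPSGD.utilityOrder n m d L G ω ε δ Δ) := by
  refine ⟨2 + 480 * (2 + K), by positivity, 1, one_pos,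
    fun n m d L G ω ε δ Δ hn hm hd hL hG hω hΔ hε hδ hδ1 hεK => ?_⟩
  have hl : 0 < Real.log (1 / δ) := Real.log_pos (one_lt_one_div hδ hδ1)
  have hR := CDPSGD.roundOrder_pos hm hd hG hω hε hl n L Δ
  have hT := Nat.one_le_ceil_iff.2 hR
  have hRT := Nat.le_ceil (CDPSGD.roundOrder n m d L G ω ε δ Δ)
  refine ⟨⌈CDPSGD.roundOrder n m d L G ω ε δ Δ⌉₊, CDPSGD.stepsize n m d _ L G ω ε δ Δ,
    CDPSGD.noiseLevel K m _ G ε δ, hT, (div_le_self hR.le (by linarith)).trans hRT, ?_,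
    CDPSGD.stepsize_pos hn hm hd hT hL hG hω hε hΔ hl, CDPSGD.noiseLevel_pos hK.le hm hT hG hε hl,
    fun b hb hbm hbT Z f hf hfG C x0 D => ⟨fun i => ?_, fun hbdd hgap => ?_⟩⟩
  · have hceil := (Nat.ceil_lt_add_one hR.le).le
    have hRA := le_mul_of_one_le_left hR.le (show 1 ≤ 2 + 480 * (2 + K) by linarith)
    linarith
  · rw [one_mul] at hbT
    exact CDPSGD.isLDP_noiseLevel hK.le hε hδ hl hεK hT hb hbm hbT hG hfG _ C x0 D i
  · exact CDPSGD.avgSqGradNorm_le_utilityOrder hK.le hε hl hn hd hL hω hΔ hT hRT hb hbm hG hf hfG C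
      x0 hbdd hgap
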